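/- Let $A,W\in\mathbb{R}^{n\times n}$, $C\in\mathbb{R}^{m\times n}$, $V\in\mathbb{R}^{m\times m}$ with $W$ positive semidefinite and $V$ positive definite, and let $\overline P$ be the steady-state error covariance of the Kalman filter of $x(k+1)=Ax(k)+w(k)$, $y(k)=Cx(k)+v(k)$ with noise covariances $W$ (of $w$) and $V$ (of $v$), i.e. a positive semidefinite matrix with $$\overline P=M-MC^\top(CMC^\top+V)^{-1}CM,\qquad M=A\overline PA^\top+W .$$ Put $P(\tau)=A^{\tau}\overline P(A^\top)^{\tau}+\sum_{t=0}^{\tau-1}A^tW(A^\top)^t$ and $c_e(\tau)=\operatorname{Tr}P(\tau)$ for $\tau\in\mathbb{N}$. Let $r_s\in(0,1]$ (success probability of the channel) and $b\in(0,1]$ (communication budget). The holding time $\tau(k)$ starts at $\tau(0)=0$. At each time $k$ the sensor chooses $a(k)\in\{0,1\}$; if $a(k)=1$ the transmission succeeds with probability $r_s$, independently of the past. Then $\tau(k+1)=0$ after a success and $\tau(k+1)=\tau(k)+1$ otherwise. An admissible policy $f$ chooses $a(k)=1$ with a probability that is a function of $\tau(0),\dots,\tau(k),a(0),\dots,a(k-1)$.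 Let $$J_e(f)=\limsup_{T\to\infty}\frac1T\,\mathbb{E}^f\sum_{k=0}^{T-1}c_e(\tau(k)),\qquad J_r(f)=\limsup_{T\to\infty}\frac1T\,\mathbb{E}^f\sum_{k=0}^{T-1}a(k).$$ Problem 2 is to minimize $J_e(f)$ over admissible policies with $J_r(f)\le b$; let $J_e^\star\in[0,\infty]$ be its infimum. For $r\in(0,1]$ let $\theta^\star(r)=\lfloor\frac1{rb}-\frac1r\rfloor$ and $q^\star(r)=\theta^\star(r)+1+\frac{b-1}{br}$, and let $g_r:\mathbb{N}\to[0,1]$ be the randomized threshold rule $g_r(\tau)=0$ for $\tau<\theta^\star(r)$, $g_r(\theta^\star(r))=q^\star(r)$, $g_r(\tau)=1$ for $\tau>\theta^\star(r)$, where $g_r(\tau)$ is the probability of transmitting in state $\tau$. Let $N_s(k)$, $N_f(k)$ be the numbers of successful and failed transmissions up to time $k$, and $\hat r_s(k)=N_s(k)/(N_s(k)+N_f(k))$. The parameter-learning policy transmits at every time $k$ with $N_s(k)=0$, and at every other time $k$ it transmits with probability $g_{\hat r_s(k)}(\tau(k))$. Let $g^{(k)}$ be the rule in force at time $k$, i.e.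 $g^{(k)}\equiv1$ if $N_s(k)=0$ and $g^{(k)}=g_{\hat r_s(k)}$ otherwise. Then: 1. the stationary policy $g_{r_s}$ is optimal for Problem 2; 2. the parameter-learning policy is admissible, and when it is run, almost surely $g^{(k)}\to g_{r_s}$ uniformly on $\mathbb{N}$ as $k\to\infty$; 3. when it is run, the average estimation error converges almost surely to the optimal value: almost surely $\frac1{k+1}\sum_{t=0}^{k}c_e(\tau(t))\to J_e^\star$, and almost surely also $J_e(g^{(k)})\to J_e^\star$, where $J_e(g^{(k)})$ is the expected average estimation error of the stationary policy $g^{(k)}$ (with $g^{(k)}$ held fixed). -/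

import Mathlib

open MeasureTheory Filter Topology
open scoped Matrix

namespace SensorScheduling

noncomputable section

/-! ## Estimation error covariance -/

/-- `P` is the steady-state (a posteriori) error covariance of the Kalman filter for
`x(k+1) = A x(k) + w(k)`, `y(k) = C x(k) + v(k)` with noise covariances `W` (of `w`) and `V`
(of `v`): it is positive semidefinite and is left unchanged by one prediction step followed by one
measurement update. -/
structure IsSteadyStateCov {n m : ℕ} (A : Matrix (Fin n) (Fin n) ℝ) (C : Matrix (Fin m) (Fin n) ℝ)
    (W : Matrix (Fin n) (Fin n) ℝ) (V : Matrix (Fin m) (Fin m) ℝ)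
    (P : Matrix (Fin n) (Fin n) ℝ) : Prop where
  posSemidef : P.PosSemidef
  fixed : P = (A * P * Aᵀ + W)
    - (A * P * Aᵀ + W) * Cᵀ * (C * (A * P * Aᵀ + W) * Cᵀ + V)⁻¹ * C * (A * P * Aᵀ + W)

/-- Error covariance at the remote estimator when the last successful reception is `τ` steps old:
`A ^ τ P (Aᵀ) ^ τ + ∑_{t < τ} A ^ t W (Aᵀ) ^ t` (which is `P` for `τ = 0`). -/
def errCov {n : ℕ} (A W P : Matrix (Fin n) (Fin n) ℝ) (τ : ℕ) : Matrix (Fin n) (Fin n) ℝ :=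
  A ^ τ * P * Aᵀ ^ τ + ∑ t ∈ Finset.range τ, A ^ t * W * Aᵀ ^ t

/-- One-stage estimation cost `c_e(τ) = Tr P(τ)`. -/
def errCost {n : ℕ} (A W P : Matrix (Fin n) (Fin n) ℝ) (τ : ℕ) : ℝ :=
  (errCov A W P τ).trace

/-! ## Scheduling policies and the controlled process -/

/-- A scheduling policy: given the holding times `τ(0), …, τ(k)` and the decisions
`a(0), …, a(k-1)`, `f k τ a` is the probability of transmitting at time `k`. -/
abbrev Policy := (k : ℕ) → (Fin (k + 1) → ℕ) → (Fin k → Bool) → ℝ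

/-- Admissible (possibly randomized, history-dependent) policies. -/
def Admissible (f : Policy) : Prop :=
  ∀ k τ a, f k τ a ∈ Set.Icc (0 : ℝ) 1

/-- Stationary randomized policy: transmit with probability `g (τ(k))`. -/
def stationary (g : ℕ → ℝ) : Policy := fun k τ _ => g (τ (Fin.last k))

/-- Sample space: at each time `k` one uniform variable `(ω k).1` for the scheduler's
randomization and one uniform variable `(ω k).2` for the channel. -/
abbrev Noise := ℕ → unitInterval × unitInterval

/-- All the uniform variables are independent. -/
def noise : Measure Noise :=
  Measure.infinitePi fun _ : ℕ => (volume : Measure (unitInterval × unitInterval))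

/-- The history `(τ(0), …, τ(k); a(0), …, a(k-1))` under policy `f` and success probability `r`,
started from `τ(0) = 0`. At time `k` a transmission is made with probability
`f k (history)`; if it is made, it succeeds with probability `r`, independently of the past. The
holding time becomes `0` after a success and increases by one otherwise. -/
def history (r : ℝ) (f : Policy) (ω : Noise) : (k : ℕ) → (Fin (k + 1) → ℕ) × (Fin k → Bool)
  | 0 => (fun _ => 0, Fin.elim0)
  | k + 1 =>
    let τ := (history r f ω k).1
    let a := (history r f ω k).2
    let act : Bool := decide (((ω k).1 : ℝ) < f k τ a)
    let next : ℕ := if act = true ∧ ((ω k).2 : ℝ) < r then 0 else τ (Fin.last k) + 1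
    (Fin.snoc (α := fun _ => ℕ) τ next, Fin.snoc (α := fun _ => Bool) a act)

/-- Holding time `τ(k)`. -/
def tau (r : ℝ) (f : Policy) (ω : Noise) (k : ℕ) : ℕ :=
  (history r f ω k).1 (Fin.last k)

/-- Transmission decision `a(k) ∈ {0, 1}`. -/
def action (r : ℝ) (f : Policy) (ω : Noise) (k : ℕ) : ℝ :=
  if (history r f ω (k + 1)).2 (Fin.last k) = true then 1 else 0

/-! ## Performance metrics and the constrained problem -/

/-- Expected average estimation error `J_e(f)` for the one-stage cost `c`, in `[-∞, ∞]`. -/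
def Je (c : ℕ → ℝ) (r : ℝ) (f : Policy) : EReal :=
  limsup (fun T : ℕ =>
    (((1 / (T : ℝ)) * ∫ ω, ∑ k ∈ Finset.range T, c (tau r f ω k) ∂noise : ℝ) : EReal)) atTop

/-- Expected average transmission rate `J_r(f)`. -/
def Jr (r : ℝ) (f : Policy) : EReal :=
  limsup (fun T : ℕ =>
    (((1 / (T : ℝ)) * ∫ ω, ∑ k ∈ Finset.range T, action r f ω k ∂noise : ℝ) : EReal)) atTop

/-- Policies that are feasible under the communication budget `b`. -/
def Feasible (r b : ℝ) (f : Policy) : Prop :=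
  Admissible f ∧ Jr r f ≤ (b : EReal)

/-- `f` solves the constrained problem: minimize `J_e` subject to `J_r ≤ b`. -/
def IsOptimal (c : ℕ → ℝ) (r b : ℝ) (f : Policy) : Prop :=
  Feasible r b f ∧ ∀ g : Policy, Feasible r b g → Je c r f ≤ Je c r g

/-- The optimal average estimation error `inf {J_e(f) : J_r(f) ≤ b}`. -/
def optValue (c : ℕ → ℝ) (r b : ℝ) : EReal :=
  sInf {x : EReal | ∃ f : Policy, Feasible r b f ∧ x = Je c r f}

/-! ## Randomized threshold rules and the learning policy -/

/-- Bernoulli randomized threshold rule: probability of transmitting in state `τ`. -/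
def thresholdRule (θ : ℕ) (q : ℝ) (τ : ℕ) : ℝ :=
  if τ < θ then 0 else if τ = θ then q else 1

/-- Threshold `⌊1 / (r b) - 1 / r⌋`. -/
def threshold (b r : ℝ) : ℕ := ⌊1 / (r * b) - 1 / r⌋₊

/-- Randomization probability `θ + 1 + (b - 1) / (b r)`, with `θ` the threshold above. -/
def switchProb (b r : ℝ) : ℝ := (threshold b r : ℝ) + 1 + (b - 1) / (b * r)

/-- The closed-form rule for budget `b` and success probability `r`. -/
def closedFormRule (b r : ℝ) : ℕ → ℝ := thresholdRule (threshold b r) (switchProb b r)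

/-- `N_s(k)`: number of successful transmissions up to time `k`. -/
def numSucc {k : ℕ} (τ : Fin (k + 1) → ℕ) (a : Fin k → Bool) : ℕ :=
  (Finset.univ.filter fun j : Fin k => a j = true ∧ τ j.succ = 0).card

/-- `N_f(k)`: number of failed transmissions up to time `k`. -/
def numFail {k : ℕ} (τ : Fin (k + 1) → ℕ) (a : Fin k → Bool) : ℕ :=
  (Finset.univ.filter fun j : Fin k => a j = true ∧ τ j.succ ≠ 0).card

/-- Maximum-likelihood estimate `N_s / (N_s + N_f)` of the success probability. -/
def rateEstimate {k : ℕ} (τ : Fin (k + 1) → ℕ) (a : Fin k → Bool) : ℝ :=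
  (numSucc τ a : ℝ) / ((numSucc τ a : ℝ) + (numFail τ a : ℝ))

/-- The rule in force after a given history: always transmit until the first success; from then
on, the closed-form rule evaluated at the current estimate. -/
def learnedRule (b : ℝ) {k : ℕ} (τ : Fin (k + 1) → ℕ) (a : Fin k → Bool) : ℕ → ℝ :=
  if numSucc τ a = 0 then fun _ => 1 else closedFormRule b (rateEstimate τ a)

/-- The parameter-learning scheduling policy (it does not know the success probability). -/
def learningPolicy (b : ℝ) : Policy := fun k τ a => learnedRule b τ a (τ (Fin.last k))

/-- The random rule in force at time `k` when the learning policy is run over a channel with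
success probability `r`. -/
def learnedRuleAt (b r : ℝ) (ω : Noise) (k : ℕ) : ℕ → ℝ :=
  learnedRule b (history r (learningPolicy b) ω k).1 (history r (learningPolicy b) ω k).2

end

end SensorScheduling

namespace SensorScheduling

noncomputable section

open ProbabilityTheory
open scoped ENNReal

/-! ## Monotonicity of the estimation cost -/

/-! The Riccati equation gives `P ≤ M`, so `errCost` is nonnegative and nondecreasing; nothing else
about the matrices is used. Stability is not assumed, so average costs may be infinite and are sums
in `ℝ≥0∞`.

The closed-form rule is `ramp x` with `x = rampPoint b r`, which is 1-Lipschitz in `x` uniformly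
over the states. Its cycles from `0` to `0` have mean length `1 / (r b)` and contain `1 / r`
transmissions on average, so it spends the budget exactly.

Optimality is stochastic minimality of the holding time. Under any policy state `j + 1` is visited
at most as often as `j`, and `0` is visited, asymptotically, at `r` times the transmission rate. A
feasible policy therefore has tail frequency at least `1 - j r b` beyond `j`, and each tail is at
least `1 - r` times the previous one. The threshold rule attains the first bound up to `threshold b
r + 1` and the second from there on (`eventually_lt_meanAvg_geInd`). Summation by parts against the
monotone cost gives `avgCost_le_Je`.

For the learning policy, successes minus `r` times transmissions form a martingale, and
transmissions never stop; the strong law `ae_tendsto_of_orthogonal`, in the clock of transmissions,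
makes the estimate converge to `r`. The same law in ordinary time turns the one-step dynamics into
asymptotic balance equations, whose only solution is the stationary occupation
(`tendsto_occupation`).

Convergence of frequencies does not yet give convergence of an unbounded average cost. From some
time on the holding time is at most a constant plus the current run of channel failures. The maximal
ergodic inequality makes the average cost of long runs small uniformly in the horizon
(`ae_sum_long_runs_le`), provided the cost is summable against `(1 - r) ^ j`; finiteness of the
optimal value forces this. If that value is infinite, the finite partial sums suffice. -/

theorem IsSteadyStateCov.posSemidef_predict_sub {n m : ℕ} {A : Matrix (Fin n) (Fin n) ℝ}
    {C : Matrix (Fin m) (Fin n) ℝ} {W : Matrix (Fin n) (Fin n) ℝ} {V : Matrix (Fin m) (Fin m) ℝ}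
    {P : Matrix (Fin n) (Fin n) ℝ} (hW : W.PosSemidef) (hV : V.PosDef)
    (hP : IsSteadyStateCov A C W V P) : (A * P * Aᵀ + W - P).PosSemidef := by
  have hM : (A * P * Aᵀ + W).PosSemidef := by
    refine Matrix.PosSemidef.add ?_ hW
    simpa using hP.posSemidef.mul_mul_conjTranspose_same A
  have hfix := hP.fixed
  set M := A * P * Aᵀ + W with hMdef
  have hMT : Mᵀ = M := by simpa using hM.isHermitian.eq
  have hS : (C * M * Cᵀ + V).PosSemidef := by
    refine Matrix.PosSemidef.add ?_ hV.posSemidef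
    simpa using hM.mul_mul_conjTranspose_same C
  have hK := hS.inv.mul_mul_conjTranspose_same (M * Cᵀ)
  -- The covariance removed by the measurement update is a congruence of the positive semidefinite
  -- `(C * M * Cᵀ + V)⁻¹`.
  have : M - P = (M * Cᵀ) * (C * M * Cᵀ + V)⁻¹ * (M * Cᵀ)ᴴ := by
    conv_lhs => rw [hfix]
    simp [Matrix.transpose_mul, hMT, Matrix.mul_assoc]
  rw [this]
  exact hK

/-- The increment is a congruence of the matrix just shown to be positive semidefinite, so its trace
is nonnegative. -/
theorem errCov_succ_sub {n : ℕ} (A W P : Matrix (Fin n) (Fin n) ℝ) (τ : ℕ) :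
    errCov A W P (τ + 1) - errCov A W P τ = A ^ τ * (A * P * Aᵀ + W - P) * (A ^ τ)ᵀ := by
  simp only [errCov, Finset.sum_range_succ, Matrix.transpose_pow, pow_succ A, pow_succ' Aᵀ,
    Matrix.mul_add, Matrix.add_mul, Matrix.mul_sub, Matrix.sub_mul, Matrix.mul_assoc]
  abel

theorem IsSteadyStateCov.errCost_monotone {n m : ℕ} {A : Matrix (Fin n) (Fin n) ℝ}
    {C : Matrix (Fin m) (Fin n) ℝ} {W : Matrix (Fin n) (Fin n) ℝ} {V : Matrix (Fin m) (Fin m) ℝ}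
    {P : Matrix (Fin n) (Fin n) ℝ} (hW : W.PosSemidef) (hV : V.PosDef)
    (hP : IsSteadyStateCov A C W V P) : Monotone (errCost A W P) := by
  refine monotone_nat_of_le_succ fun τ => ?_
  have h := ((hP.posSemidef_predict_sub hW hV).mul_mul_conjTranspose_same (A ^ τ)).trace_nonneg
  rw [Matrix.conjTranspose_eq_transpose_of_trivial, ← errCov_succ_sub, Matrix.trace_sub] at h
  exact sub_nonneg.1 h

theorem IsSteadyStateCov.errCost_nonneg {n m : ℕ} {A : Matrix (Fin n) (Fin n) ℝ}
    {C : Matrix (Fin m) (Fin n) ℝ} {W : Matrix (Fin n) (Fin n) ℝ} {V : Matrix (Fin m) (Fin m) ℝ}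
    {P : Matrix (Fin n) (Fin n) ℝ} (hW : W.PosSemidef) (hV : V.PosDef)
    (hP : IsSteadyStateCov A C W V P) (τ : ℕ) : 0 ≤ errCost A W P τ := by
  refine le_trans ?_ (hP.errCost_monotone hW hV (Nat.zero_le τ))
  simpa [errCost, errCov] using hP.posSemidef.trace_nonneg

/-! ## Threshold rules in ramp form -/

/-- The rule `τ ↦ min (max (τ + 1 - x) 0) 1`. -/
def ramp (x : ℝ) (j : ℕ) : ℝ := max 0 (min 1 ((j : ℝ) + 1 - x))

theorem ramp_nonneg (x : ℝ) (j : ℕ) : 0 ≤ ramp x j := le_max_left _ _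

theorem ramp_le_one (x : ℝ) (j : ℕ) : ramp x j ≤ 1 := max_le zero_le_one (min_le_left _ _)

theorem ramp_mem (x : ℝ) (j : ℕ) : ramp x j ∈ Set.Icc (0 : ℝ) 1 :=
  ⟨ramp_nonneg x j, ramp_le_one x j⟩

theorem ramp_of_le {x : ℝ} {j : ℕ} (h : x ≤ j) : ramp x j = 1 := by
  rw [ramp, min_eq_left (by linarith), max_eq_right zero_le_one]

theorem ramp_of_ge {x : ℝ} {j : ℕ} (h : (j : ℝ) + 1 ≤ x) : ramp x j = 0 := by
  rw [ramp, max_eq_left]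
  exact (min_le_right _ _).trans (by linarith)

theorem ramp_of_between {x : ℝ} {j : ℕ} (h : (j : ℝ) ≤ x) (h' : x ≤ j + 1) :
    ramp x j = j + 1 - x := by
  rw [ramp, min_eq_right (by linarith), max_eq_right (by linarith)]

/-- Independence of the bound from `j` turns convergence of the estimate into uniform convergence of
the rules. -/
theorem abs_ramp_sub_le (x y : ℝ) (j : ℕ) : |ramp x j - ramp y j| ≤ |x - y| := by
  refine (abs_max_sub_max_le_max _ _ _ _).trans ?_
  refine max_le (by simp) ((abs_min_sub_min_le_max _ _ _ _).trans (max_le (by simp) ?_))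
  rw [abs_sub_comm x y]
  exact le_of_eq (by ring_nf)

/-- The real number whose integer part is the threshold. -/
def rampPoint (b r : ℝ) : ℝ := 1 / (r * b) - 1 / r

theorem rampPoint_nonneg {b r : ℝ} (hb : b ∈ Set.Ioc (0 : ℝ) 1) (hr : 0 < r) :
    0 ≤ rampPoint b r := by
  have h0 := hb.1
  have h1 := hb.2
  have : rampPoint b r = (1 - b) / (r * b) := by
    rw [rampPoint]; field_simp
  rw [this]
  exact div_nonneg (by linarith) (by positivity)

theorem rampPoint_lt {b r : ℝ} : rampPoint b r < (threshold b r + 1 : ℕ) := by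
  push_cast
  exact Nat.lt_floor_add_one _

theorem threshold_le {b r : ℝ} (hb : b ∈ Set.Ioc (0 : ℝ) 1) (hr : 0 < r) :
    (threshold b r : ℝ) ≤ rampPoint b r :=
  Nat.floor_le (rampPoint_nonneg hb hr)

/-- At the integer part of `rampPoint b r` the ramp takes the value `switchProb b r`. The threshold
and the switching probability may jump as `r` varies; this form shows that the rule does not. -/
theorem closedFormRule_eq_ramp {b r : ℝ} (hb : b ∈ Set.Ioc (0 : ℝ) 1) (hr : 0 < r) :
    closedFormRule b r = ramp (rampPoint b r) := by
  have h0 := hb.1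
  have h1 := threshold_le hb hr
  have h2 := rampPoint_lt (b := b) (r := r)
  push_cast at h2
  funext j
  rw [closedFormRule, thresholdRule]
  split_ifs with hlt heq
  · have : (j : ℝ) + 1 ≤ threshold b r := by exact_mod_cast hlt
    rw [ramp_of_ge (by linarith)]
  · subst heq
    rw [ramp_of_between h1 h2.le, switchProb, rampPoint]
    field_simp
    ring
  · have : (threshold b r : ℝ) + 1 ≤ j := by
      have : threshold b r + 1 ≤ j := by omega
      exact_mod_cast this
    rw [ramp_of_le (by linarith)]

theorem tendsto_rampPoint {ι : Type*} {l : Filter ι} {s : ι → ℝ} {b r : ℝ} (hb : 0 < b)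
    (hr : 0 < r) (h : Tendsto s l (𝓝 r)) :
    Tendsto (fun k => rampPoint b (s k)) l (𝓝 (rampPoint b r)) := by
  unfold rampPoint
  exact (tendsto_const_nhds.div (h.mul_const b) (by positivity)).sub
    (tendsto_const_nhds.div h hr.ne')

/-! ## Occupation frequencies of a stationary rule -/

/-- Probability of reaching holding time `j` before the first success, starting from `0`. -/
def reach (r : ℝ) (g : ℕ → ℝ) (j : ℕ) : ℝ := ∏ i ∈ Finset.range j, (1 - r * g i)

theorem reach_succ (r : ℝ) (g : ℕ → ℝ) (j : ℕ) :
    reach r g (j + 1) = reach r g j * (1 - r * g j) := Finset.prod_range_succ _ _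

@[simp] theorem reach_zero (r : ℝ) (g : ℕ → ℝ) : reach r g 0 = 1 := Finset.prod_range_zero _

theorem factor_mem {r : ℝ} (hr : r ∈ Set.Ioc (0 : ℝ) 1) {y : ℝ} (hy : y ∈ Set.Icc (0 : ℝ) 1) :
    0 ≤ 1 - r * y ∧ 1 - r * y ≤ 1 ∧ 1 - r ≤ 1 - r * y := by
  obtain ⟨h0, h1⟩ := hr
  obtain ⟨h2, h3⟩ := hy
  refine ⟨?_, ?_, ?_⟩ <;> nlinarith

theorem pow_le_reach {r : ℝ} (hr : r ∈ Set.Ioc (0 : ℝ) 1) {g : ℕ → ℝ}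
    (hg : ∀ j, g j ∈ Set.Icc (0 : ℝ) 1) (j : ℕ) : (1 - r) ^ j ≤ reach r g j := by
  have := Finset.prod_le_prod (s := Finset.range j) (f := fun _ => 1 - r)
    (g := fun i => 1 - r * g i) (fun _ _ => by linarith [hr.2])
    (fun i _ => (factor_mem hr (hg i)).2.2)
  simpa [reach] using this

theorem reach_nonneg {r : ℝ} (hr : r ∈ Set.Ioc (0 : ℝ) 1) {g : ℕ → ℝ}
    (hg : ∀ j, g j ∈ Set.Icc (0 : ℝ) 1) (j : ℕ) : 0 ≤ reach r g j :=
  Finset.prod_nonneg fun i _ => (factor_mem hr (hg i)).1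

/-- Factors below `K` are at most `1`, the others equal `1 - r`; truncated subtraction makes the
exponent `0` below `K`. -/
theorem reach_le_pow {r : ℝ} (hr : r ∈ Set.Ioc (0 : ℝ) 1) {g : ℕ → ℝ}
    (hg : ∀ j, g j ∈ Set.Icc (0 : ℝ) 1) {K : ℕ} (hK : ∀ j, K ≤ j → g j = 1) (j : ℕ) :
    reach r g j ≤ (1 - r) ^ (j - K) := by
  induction j with
  | zero => simp
  | succ j ih =>
    rw [reach_succ]
    have h0 := reach_nonneg hr hg j
    have hf := factor_mem hr (hg j)
    by_cases h : K ≤ j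
    · rw [hK j h, mul_one, Nat.sub_add_comm h, pow_succ]
      exact mul_le_mul_of_nonneg_right ih (by linarith [hr.2])
    · rw [Nat.sub_eq_zero_of_le (by omega)] at ih ⊢
      rw [pow_zero] at ih ⊢
      nlinarith

/-- Expected length of a cycle between two visits to `0`, for a rule that transmits surely in the
states from `K` on. -/
def cycleLength (r : ℝ) (g : ℕ → ℝ) (K : ℕ) : ℝ :=
  ∑ j ∈ Finset.range K, reach r g j + reach r g K / r

theorem one_le_cycleLength {r : ℝ} (hr : r ∈ Set.Ioc (0 : ℝ) 1) {g : ℕ → ℝ}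
    (hg : ∀ j, g j ∈ Set.Icc (0 : ℝ) 1) (K : ℕ) : 1 ≤ cycleLength r g K := by
  unfold cycleLength
  have h0 := hr.1
  cases K with
  | zero => simpa using (one_le_inv₀ h0).2 hr.2
  | succ K =>
    rw [Finset.sum_range_succ']
    have h1 : 0 ≤ ∑ k ∈ Finset.range K, reach r g (k + 1) :=
      Finset.sum_nonneg fun j _ => reach_nonneg hr hg _
    have h2 : 0 ≤ reach r g (K + 1) / r := div_nonneg (reach_nonneg hr hg _) h0.le
    rw [reach_zero]
    linarith

/-- Stationary probability of holding time `j`. -/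
def occupation (r : ℝ) (g : ℕ → ℝ) (K j : ℕ) : ℝ := reach r g j / cycleLength r g K

theorem occupation_nonneg {r : ℝ} (hr : r ∈ Set.Ioc (0 : ℝ) 1) {g : ℕ → ℝ}
    (hg : ∀ j, g j ∈ Set.Icc (0 : ℝ) 1) (K j : ℕ) : 0 ≤ occupation r g K j :=
  div_nonneg (reach_nonneg hr hg j) (zero_le_one.trans (one_le_cycleLength hr hg K))

theorem occupation_le_reach {r : ℝ} (hr : r ∈ Set.Ioc (0 : ℝ) 1) {g : ℕ → ℝ}
    (hg : ∀ j, g j ∈ Set.Icc (0 : ℝ) 1) (K j : ℕ) : occupation r g K j ≤ reach r g j :=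
  div_le_self (reach_nonneg hr hg j) (one_le_cycleLength hr hg K)

/-- The balance relations `hstep` make every `p T j` asymptotic to `reach r g j * p T 0`, and total
mass one forces `p T 0` to `1 / cycleLength r g K`. The states from `K` on are lumped into `u`, so
no infinite sum is exchanged with the limit. It serves both for expected frequencies and for
frequencies along a path. -/
theorem tendsto_occupation {r : ℝ} (hr : r ∈ Set.Ioc (0 : ℝ) 1) {g : ℕ → ℝ}
    (hg : ∀ j, g j ∈ Set.Icc (0 : ℝ) 1) {K : ℕ} {p : ℕ → ℕ → ℝ} {u : ℕ → ℝ}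
    (hsum : ∀ᶠ T in atTop, ∑ j ∈ Finset.range K, p T j + u T = 1)
    (hstep : ∀ j, Tendsto (fun T => p T (j + 1) - p T j * (1 - r * g j)) atTop (𝓝 0))
    (htail : Tendsto (fun T => p T K - r * u T) atTop (𝓝 0)) (j : ℕ) :
    Tendsto (fun T => p T j) atTop (𝓝 (occupation r g K j)) := by
  have h0 := hr.1
  have hA : ∀ j, Tendsto (fun T => p T j - reach r g j * p T 0) atTop (𝓝 0) := by
    intro j
    induction j with
    | zero => simp
    | succ j ih =>
      have := (hstep j).add (ih.mul_const (1 - r * g j))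
      rw [zero_mul, add_zero] at this
      refine this.congr fun T => ?_
      rw [reach_succ]; ring
  have hu : Tendsto (fun T => u T - reach r g K / r * p T 0) atTop (𝓝 0) := by
    have := ((hA K).sub htail).const_mul (1 / r)
    rw [sub_zero, mul_zero] at this
    refine this.congr fun T => ?_
    field_simp
    ring
  have hs : Tendsto (fun T => ∑ j ∈ Finset.range K, (p T j - reach r g j * p T 0)) atTop (𝓝 0) := by
    simpa using tendsto_finsetSum (Finset.range K) fun j _ => hA j
  have hZ := one_le_cycleLength hr hg K
  have h1 : Tendsto (fun T => 1 - cycleLength r g K * p T 0) atTop (𝓝 0) := by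
    have := hs.add hu
    rw [add_zero] at this
    refine this.congr' ?_
    filter_upwards [hsum] with T hT
    rw [Finset.sum_sub_distrib, ← Finset.sum_mul, cycleLength, ← hT]
    ring
  have h2 : Tendsto (fun T => p T 0) atTop (𝓝 (1 / cycleLength r g K)) := by
    have := (tendsto_const_nhds (x := (1 : ℝ))).sub h1
    rw [sub_zero] at this
    refine (this.div_const (cycleLength r g K)).congr fun T => ?_
    field_simp
    ring
  have h3 := (hA j).add (h2.const_mul (reach r g j))
  rw [zero_add] at h3
  refine (h3.congr fun T => by ring).trans (le_of_eq ?_)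
  rw [occupation]
  ring_nf

theorem reach_ramp_of_le {r x : ℝ} {j : ℕ} (h : (j : ℝ) ≤ x) : reach r (ramp x) j = 1 := by
  refine Finset.prod_eq_one fun i hi => ?_
  have : (i : ℝ) + 1 ≤ j := by exact_mod_cast Finset.mem_range.1 hi
  rw [ramp_of_ge (by linarith), mul_zero, sub_zero]

/-- With `θ` the threshold and `x` the ramp point, the length is `(θ + 1) + (1 - r (θ + 1 - x)) / r
= x + 1 / r`. -/
theorem cycleLength_ramp {b r : ℝ} (hb : b ∈ Set.Ioc (0 : ℝ) 1) (hr : 0 < r) :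
    cycleLength r (ramp (rampPoint b r)) (threshold b r + 1) = 1 / (r * b) := by
  have h0 := hb.1
  have h1 := threshold_le hb hr
  have h2 := rampPoint_lt (b := b) (r := r)
  push_cast at h2
  rw [cycleLength, reach_succ, reach_ramp_of_le h1, ramp_of_between h1 h2.le,
    Finset.sum_congr rfl fun j hj => reach_ramp_of_le (r := r) (x := rampPoint b r) (j := j) ?_]
  · simp only [Finset.sum_const, Finset.card_range, nsmul_eq_mul]
    push_cast
    rw [rampPoint]
    field_simp
    ring
  · have : (j : ℝ) ≤ threshold b r := by
      exact_mod_cast Nat.lt_succ_iff.1 (Finset.mem_range.1 hj)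
    linarith

/-! ## Convergence of average costs -/

/-- Partial sums give the lower bound even when the limit is infinite. Tail control is needed only
for the upper bound, hence only when the limit is finite. -/
theorem tendsto_tsum_mul_of_tail {c : ℕ → ℝ≥0∞} (hc : ∀ j, c j ≠ ∞) {p : ℕ → ℕ → ℝ≥0∞}
    {q : ℕ → ℝ≥0∞} (hp : ∀ j, Tendsto (fun T => p T j) atTop (𝓝 (q j)))
    (htail : ∑' j, c j * q j ≠ ∞ → ∀ ε : ℝ≥0∞, 0 < ε → ∃ L, ∀ᶠ T in atTop,
      ∑' j, c (j + L) * p T (j + L) ≤ ε) :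
    Tendsto (fun T => ∑' j, c j * p T j) atTop (𝓝 (∑' j, c j * q j)) := by
  have hfin : ∀ L, Tendsto (fun T => ∑ j ∈ Finset.range L, c j * p T j) atTop
      (𝓝 (∑ j ∈ Finset.range L, c j * q j)) := fun L =>
    tendsto_finsetSum _ fun j _ => ENNReal.Tendsto.const_mul (hp j) (Or.inr (hc j))
  refine tendsto_order.2 ⟨fun a ha => ?_, fun a ha => ?_⟩
  · obtain ⟨L, hL⟩ := ((tendsto_order.1 ENNReal.summable.hasSum.tendsto_sum_nat).1 a ha).exists
    filter_upwards [(tendsto_order.1 (hfin L)).1 a hL] with T hT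
    exact hT.trans_le (ENNReal.sum_le_tsum _)
  · have hV : ∑' j, c j * q j ≠ ∞ := ha.ne_top
    obtain ⟨ε, hε, hεa⟩ := ENNReal.lt_iff_exists_add_pos_lt.1 ha
    have hε2 : (0 : ℝ≥0∞) < (ε : ℝ≥0∞) / 2 := ENNReal.half_pos (by exact_mod_cast hε.ne')
    obtain ⟨L, hL⟩ := htail hV _ hε2
    have hlt : ∑ j ∈ Finset.range L, c j * q j < ∑' j, c j * q j + (ε : ℝ≥0∞) / 2 :=
      (ENNReal.sum_le_tsum _).trans_lt (ENNReal.lt_add_right hV hε2.ne')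
    filter_upwards [hL, (tendsto_order.1 (hfin L)).2 _ hlt] with T hT1 hT2
    rw [← Summable.sum_add_tsum_nat_add' (k := L) (f := fun j => c j * p T j) ENNReal.summable]
    refine (add_le_add hT2.le hT1).trans_lt ?_
    rwa [add_assoc, ENNReal.add_halves]

theorem tendsto_tsum_mul_of_dominated {c : ℕ → ℝ≥0∞} (hc : ∀ j, c j ≠ ∞) {p : ℕ → ℕ → ℝ≥0∞}
    {q : ℕ → ℝ≥0∞} (hp : ∀ j, Tendsto (fun T => p T j) atTop (𝓝 (q j))) {β : ℕ → ℝ≥0∞}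
    (hle : ∀ᶠ T in atTop, ∀ j, p T j ≤ β j)
    (hβ : ∑' j, c j * q j ≠ ∞ → ∑' j, c j * β j ≠ ∞) :
    Tendsto (fun T => ∑' j, c j * p T j) atTop (𝓝 (∑' j, c j * q j)) := by
  refine tendsto_tsum_mul_of_tail hc hp fun hV ε hε => ?_
  obtain ⟨L, hL⟩ := ((tendsto_order.1 (ENNReal.tendsto_sum_nat_add _ (hβ hV))).2 ε hε).exists
  refine ⟨L, hle.mono fun T hT => le_trans (ENNReal.tsum_le_tsum fun j => ?_) hL.le⟩
  gcongr
  exact hT _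

/-- Average cost of a stationary rule that transmits surely in the states from `K` on. -/
def avgCost (c : ℕ → ℝ) (r : ℝ) (g : ℕ → ℝ) (K : ℕ) : ℝ≥0∞ :=
  ∑' j, ENNReal.ofReal (c j) * ENNReal.ofReal (occupation r g K j)

/-- Every rule reaches `j` with probability at least `(1 - r) ^ j`, so finite cost for one rule
yields a summable dominating sequence for all. A shift by `C` costs the factor `(1 - r) ^ (-C)`,
which is why `r = 1` is separate. -/
theorem tsum_geometric_ne_top_of_avgCost_ne_top {c : ℕ → ℝ} {r : ℝ} (hr : r ∈ Set.Ioc (0 : ℝ) 1)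
    {g : ℕ → ℝ} (hg : ∀ j, g j ∈ Set.Icc (0 : ℝ) 1) {K : ℕ} (h : avgCost c r g K ≠ ∞) (C : ℕ) :
    ∑' j, ENNReal.ofReal (c (j + C)) * ENNReal.ofReal ((1 - r) ^ j) ≠ ∞ := by
  have hZ := one_le_cycleLength hr hg K
  rcases hr.2.eq_or_lt with h1 | h1
  · rw [tsum_eq_single 0]
    · simp
    · intro j hj
      simp [h1, hj]
  · have h1r : 0 < 1 - r := by linarith
    refine ne_top_of_le_ne_top (ENNReal.mul_ne_top
      (ENNReal.ofReal_ne_top (r := cycleLength r g K * ((1 - r) ^ C)⁻¹)) h) ?_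
    rw [avgCost, ← ENNReal.tsum_mul_left]
    refine le_trans ?_ (ENNReal.tsum_comp_le_tsum_of_injective (add_left_injective C) _)
    refine ENNReal.tsum_le_tsum fun j => ?_
    rw [mul_left_comm]
    gcongr
    rw [← ENNReal.ofReal_mul (by positivity)]
    refine ENNReal.ofReal_le_ofReal ?_
    have := pow_le_reach hr hg (j + C)
    rw [pow_add] at this
    simp only [occupation]
    field_simp
    exact this

theorem tsum_reach_bound_ne_top {c : ℕ → ℝ} {r : ℝ} {K : ℕ}
    (h : ∑' j, ENNReal.ofReal (c (j + K)) * ENNReal.ofReal ((1 - r) ^ j) ≠ ∞) :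
    ∑' j, ENNReal.ofReal (c j) * ENNReal.ofReal ((1 - r) ^ (j - K)) ≠ ∞ := by
  rw [← Summable.sum_add_tsum_nat_add' (k := K) ENNReal.summable]
  refine ENNReal.add_ne_top.2 ⟨?_, by simpa using h⟩
  exact ENNReal.sum_ne_top.2 fun j _ =>
    ENNReal.mul_ne_top ENNReal.ofReal_ne_top ENNReal.ofReal_ne_top

/-- Since `K` lies strictly above `x`, eventually all rules `ramp (y k)` transmit surely from this
same `K` on and share one geometric bound. -/
theorem tendsto_avgCost_ramp {c : ℕ → ℝ} {r : ℝ} (hr : r ∈ Set.Ioc (0 : ℝ) 1) {x : ℝ} {K : ℕ}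
    (hx : x < K) {y : ℕ → ℝ} (hy : Tendsto y atTop (𝓝 x)) :
    Tendsto (fun k => avgCost c r (ramp (y k)) K) atTop (𝓝 (avgCost c r (ramp x) K)) := by
  have hramp : ∀ j, Tendsto (fun k => ramp (y k) j) atTop (𝓝 (ramp x j)) := fun j => by
    unfold ramp
    exact tendsto_const_nhds.max (tendsto_const_nhds.min (tendsto_const_nhds.sub hy))
  have hreach : ∀ j, Tendsto (fun k => reach r (ramp (y k)) j) atTop (𝓝 (reach r (ramp x) j)) :=
    fun j => tendsto_finsetProd _ fun i _ => tendsto_const_nhds.sub ((hramp i).const_mul r)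
  have hcyc : Tendsto (fun k => cycleLength r (ramp (y k)) K) atTop
      (𝓝 (cycleLength r (ramp x) K)) :=
    (tendsto_finsetSum _ fun i _ => hreach i).add ((hreach K).div_const r)
  have hZ := one_le_cycleLength hr (ramp_mem x) K
  refine tendsto_tsum_mul_of_dominated (fun _ => ENNReal.ofReal_ne_top)
    (fun j => ENNReal.tendsto_ofReal ((hreach j).div hcyc (by linarith)))
    (β := fun j => ENNReal.ofReal ((1 - r) ^ (j - K))) ?_ fun hV =>
      tsum_reach_bound_ne_top (tsum_geometric_ne_top_of_avgCost_ne_top hr (ramp_mem x) hV K)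
  filter_upwards [hy.eventually_lt_const hx] with k hk j
  refine ENNReal.ofReal_le_ofReal ((occupation_le_reach hr (ramp_mem _) K j).trans
    (reach_le_pow hr (ramp_mem _) (fun i hi => ramp_of_le (hk.le.trans ?_)) j))
  exact_mod_cast hi

/-! ## The noise process and its filtration -/

instance : IsProbabilityMeasure noise := by
  unfold noise
  infer_instance

/-- The noise variables before time `k`. -/
def past : Filtration ℕ (inferInstance : MeasurableSpace Noise) where
  seq k := ⨆ s ∈ Set.Iio k, MeasurableSpace.comap (fun ω : Noise => ω s) inferInstance
  mono' _ _ h := biSup_mono fun _ hs => lt_of_lt_of_le hs h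
  le' _ := iSup₂_le fun s _ => (measurable_pi_apply s).comap_le

theorem measurable_past_eval {s k : ℕ} (h : s < k) : Measurable[past k] fun ω : Noise => ω s := by
  refine Measurable.of_comap_le ?_
  exact le_iSup₂_of_le (f := fun s (_ : s ∈ Set.Iio k) =>
    MeasurableSpace.comap (fun ω : Noise => ω s) inferInstance) s h le_rfl

theorem indep_past (k : ℕ) :
    Indep (past k) (MeasurableSpace.comap (fun ω : Noise => ω k) inferInstance) noise := by
  have h : iIndepFun (fun (i : ℕ) (ω : Noise) => ω i) noise :=
    iIndepFun_infinitePi (X := fun _ x => x) fun _ => measurable_id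
  have h2 := indep_iSup_of_disjoint (fun i => (measurable_pi_apply i).comap_le) h.iIndep
    (S := Set.Iio k) (T := {k}) (by simp)
  simpa [past] using h2

theorem map_noise_eval (k : ℕ) : noise.map (fun ω => ω k) = volume :=
  Measure.infinitePi_map_eval _ k

/-- The noise at time `k` is independent of `past k`, so the joint law is a product and Fubini
integrates out the fresh noise. -/
theorem integral_step {Γ : Type*} [MeasurableSpace Γ] {k : ℕ} {Y : Noise → Γ}
    (hY : Measurable[past k] Y) {ψ : Γ × (unitInterval × unitInterval) → ℝ} (hψ : Measurable ψ)
    (hint : Integrable (fun ω => ψ (Y ω, ω k)) noise) :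
    ∫ ω, ψ (Y ω, ω k) ∂noise = ∫ ω, (∫ z : unitInterval × unitInterval, ψ (Y ω, z)) ∂noise := by
  have hY' : Measurable Y := hY.mono (past.le k) le_rfl
  have hk : Measurable fun ω : Noise => ω k := measurable_pi_apply k
  have hind : IndepFun Y (fun ω : Noise => ω k) noise :=
    indep_of_indep_of_le_left (indep_past k) hY.comap_le
  have hmap := hind.map_prod_eq_prod_map_map hY'.aemeasurable hk.aemeasurable
  rw [map_noise_eval] at hmap
  have hpair : Measurable fun ω : Noise => (Y ω, ω k) := hY'.prodMk hk
  have hint' : Integrable ψ ((noise.map Y).prod volume) := by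
    rw [← hmap]
    exact (integrable_map_measure hψ.aestronglyMeasurable hpair.aemeasurable).2 hint
  have hprob : IsProbabilityMeasure (noise.map Y) :=
    Measure.isProbabilityMeasure_map hY'.aemeasurable
  calc ∫ ω, ψ (Y ω, ω k) ∂noise = ∫ y, ψ y ∂(noise.map fun ω => (Y ω, ω k)) :=
        (integral_map hpair.aemeasurable hψ.aestronglyMeasurable).symm
    _ = ∫ y, (∫ z : unitInterval × unitInterval, ψ (y, z)) ∂(noise.map Y) := by
        rw [hmap, integral_prod _ hint']
    _ = _ := integral_map hY'.aemeasurable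
        hψ.stronglyMeasurable.integral_prod_right'.aestronglyMeasurable

theorem integrable_of_abs_le {X : Noise → ℝ} (hX : Measurable X) {B : ℝ} (hB : ∀ ω, |X ω| ≤ B) :
    Integrable X noise :=
  Integrable.of_bound hX.aestronglyMeasurable B (ae_of_all _ hB)

/-- Indicator of `u < p`. -/
def below (p : ℝ) (u : unitInterval) : ℝ := if (u : ℝ) < p then 1 else 0

theorem below_mem (p : ℝ) (u : unitInterval) : below p u ∈ Set.Icc (0 : ℝ) 1 := by
  unfold below
  split_ifs <;> simp

theorem measurable_below {Γ : Type*} [MeasurableSpace Γ] {p : Γ → ℝ} {u : Γ → unitInterval}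
    (hp : Measurable p) (hu : Measurable u) : Measurable fun y => below (p y) (u y) :=
  Measurable.ite (measurableSet_lt (measurable_subtype_coe.comp hu) hp) measurable_const
    measurable_const

theorem integral_below {p : ℝ} (hp : p ∈ Set.Icc (0 : ℝ) 1) : ∫ u, below p u = p := by
  have : below p = (Set.Iio (⟨p, hp⟩ : unitInterval)).indicator fun _ => (1 : ℝ) := by
    funext u
    simp [below, Set.indicator_apply, ← Subtype.coe_lt_coe]
  rw [this, integral_indicator measurableSet_Iio]
  simp [Measure.real, ENNReal.toReal_ofReal hp.1]

theorem integral_below_mul {p r : ℝ} (hp : p ∈ Set.Icc (0 : ℝ) 1) (hr : r ∈ Set.Icc (0 : ℝ) 1) :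
    ∫ z : unitInterval × unitInterval, below p z.1 * below r z.2 = p * r := by
  rw [Measure.volume_eq_prod, integral_prod_mul, integral_below hp, integral_below hr]

/-- A decision is a strict comparison with a point of the closed unit interval; off this null set,
probability `1` forces a transmission. -/
theorem ae_noise_fst_lt_one : ∀ᵐ ω ∂noise, ∀ k : ℕ, ((ω k).1 : ℝ) < 1 := by
  rw [ae_all_iff]
  intro k
  have h : ∀ᵐ z : unitInterval × unitInterval, (z.1 : ℝ) < 1 := by
    have h1 : ∀ᵐ u : unitInterval, u ≠ 1 := by
      simp [ae_iff]
    have h2 := Measure.quasiMeasurePreserving_fst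
      (μ := (volume : Measure unitInterval)) (ν := (volume : Measure unitInterval)) |>.ae h1
    filter_upwards [h2] with z hz
    exact lt_of_le_of_ne z.1.2.2 fun h => hz (Subtype.ext h)
  rw [← map_noise_eval k] at h
  exact ae_of_ae_map (measurable_pi_apply k).aemeasurable h

/-! ## A strong law for martingale differences in their own clock -/

theorem sum_mul_eq_sub_sum (w D : ℕ → ℝ) (z : ℝ) (T : ℕ) :
    ∑ t ∈ Finset.range T, w t * D t = w T * (∑ t ∈ Finset.range T, D t - z) + w 0 * z -
      ∑ t ∈ Finset.range T, (w (t + 1) - w t) * (∑ s ∈ Finset.range (t + 1), D s - z) := by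
  induction T with
  | zero => simp
  | succ T ih =>
    rw [Finset.sum_range_succ, ih, Finset.sum_range_succ (n := T) (f := fun t =>
      (w (t + 1) - w t) * (∑ s ∈ Finset.range (t + 1), D s - z)), Finset.sum_range_succ D]
    ring

/-- Kronecker's lemma. -/
theorem tendsto_sum_mul_div {w D : ℕ → ℝ} (hw : Monotone w) (hw' : Tendsto w atTop atTop) {z : ℝ}
    (hz : Tendsto (fun T => ∑ t ∈ Finset.range T, D t) atTop (𝓝 z)) :
    Tendsto (fun T => (∑ t ∈ Finset.range T, w t * D t) / w T) atTop (𝓝 0) := by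
  have hz0 : Tendsto (fun T => ∑ t ∈ Finset.range T, D t - z) atTop (𝓝 0) := by
    simpa using hz.sub_const z
  have hsum : ∀ T, ∑ t ∈ Finset.range T, (w (t + 1) - w t) = w T - w 0 :=
    Finset.sum_range_sub w
  -- Averaging a null sequence with weights the increments of `w` gives a null sequence, as the
  -- total weight diverges.
  have hlit : (fun T => ∑ t ∈ Finset.range T,
      (w (t + 1) - w t) * (∑ s ∈ Finset.range (t + 1), D s - z)) =o[atTop]
        fun T => ∑ t ∈ Finset.range T, (w (t + 1) - w t) := by
    refine Asymptotics.IsLittleO.sum_range ?_ (fun t => sub_nonneg.2 (hw t.le_succ)) ?_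
    · have h1 : (fun t : ℕ => ∑ s ∈ Finset.range (t + 1), D s - z) =o[atTop] fun _ => (1 : ℝ) :=
        (Asymptotics.isLittleO_one_iff ℝ).2 (hz0.comp (tendsto_add_atTop_nat 1))
      simpa using (Asymptotics.isBigO_refl (fun t => w (t + 1) - w t) atTop).mul_isLittleO h1
    · simp_rw [hsum]
      exact tendsto_atTop_add_const_right _ _ hw'
  have hO : (fun T => ∑ t ∈ Finset.range T, (w (t + 1) - w t)) =O[atTop] w := by
    simp_rw [hsum]
    refine (Asymptotics.isBigO_refl _ _).sub ?_
    exact (Asymptotics.isLittleO_const_left.2 (Or.inr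
      (tendsto_norm_atTop_atTop.comp hw'))).isBigO
  have h2 := (hlit.trans_isBigO hO).tendsto_div_nhds_zero
  have h3 : Tendsto (fun T => w 0 * z / w T) atTop (𝓝 0) := hw'.const_div_atTop _
  have h4 := (hz0.add h3).sub h2
  rw [add_zero, sub_zero] at h4
  refine h4.congr' ?_
  filter_upwards [hw'.eventually_gt_atTop 0] with T hT
  rw [sum_mul_eq_sub_sum w D z T]
  field_simp

/-- `1 +` the number of clock ticks before time `t`. -/
def clockWeight (a : ℕ → Noise → ℝ) (t : ℕ) (ω : Noise) : ℝ := 1 + ∑ s ∈ Finset.range t, a s ω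

/-- Strong law for innovations `X` that are orthogonal to the past and bounded by the ticks `a` of
a clock: their average over the ticks tends to `0` if the clock does not stop. -/
theorem ae_tendsto_of_orthogonal {a X : ℕ → Noise → ℝ}
    (ha : ∀ t, Measurable[past (t + 1)] (a t)) (ha' : ∀ t ω, a t ω = 0 ∨ a t ω = 1)
    (hX : ∀ t, Measurable[past (t + 1)] (X t)) (hX' : ∀ t ω, |X t ω| ≤ a t ω)
    (horth : ∀ t (H : Noise → ℝ), Measurable[past t] H → (∃ B, ∀ ω, |H ω| ≤ B) →
      ∫ ω, H ω * X t ω ∂noise = 0) :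
    ∀ᵐ ω ∂noise, Tendsto (fun T => ∑ t ∈ Finset.range T, a t ω) atTop atTop →
      Tendsto (fun T => (∑ t ∈ Finset.range T, X t ω) / ∑ t ∈ Finset.range T, a t ω)
        atTop (𝓝 0) := by
  set w := clockWeight a with hw_def
  have ha0 : ∀ t ω, 0 ≤ a t ω := fun t ω => (abs_nonneg _).trans (hX' t ω)
  have hw1 : ∀ t ω, 1 ≤ w t ω := fun t ω => by
    have := Finset.sum_nonneg fun s (_ : s ∈ Finset.range t) => ha0 s ω
    simp only [hw_def, clockWeight]
    linarith
  have hwsucc : ∀ t ω, w (t + 1) ω = w t ω + a t ω := fun t ω => by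
    simp only [hw_def, clockWeight, Finset.sum_range_succ]
    ring
  have hwm : ∀ t, Measurable[past t] (w t) := fun t =>
    measurable_const.add (Finset.measurable_fun_sum _ fun s hs =>
      (ha s).mono (past.mono (Finset.mem_range.1 hs)) le_rfl)
  -- The weight `w t` is known before time `t`, so `Z` is a martingale. Once it converges,
  -- Kronecker's lemma with the random weights `w` gives the claim.
  set Z : ℕ → Noise → ℝ := fun T ω => ∑ t ∈ Finset.range T, X t ω / w t ω with hZ_def
  have hDle : ∀ t ω, |X t ω / w t ω| ≤ 1 := fun t ω => by
    rw [abs_div, abs_of_pos (by linarith [hw1 t ω] : 0 < w t ω), div_le_one (by linarith [hw1 t ω])]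
    refine (hX' t ω).trans (le_trans ?_ (hw1 t ω))
    rcases ha' t ω with h | h <;> simp [h]
  have hZm : ∀ T, Measurable[past T] (Z T) := fun T =>
    Finset.measurable_fun_sum _ fun s hs =>
      ((hX s).mono (past.mono (Finset.mem_range.1 hs)) le_rfl).div
        ((hwm s).mono (past.mono (Finset.mem_range.1 hs).le) le_rfl)
  have hZb : ∀ T ω, |Z T ω| ≤ T := fun T ω => by
    refine (Finset.abs_sum_le_sum_abs _ _).trans ?_
    refine (Finset.sum_le_sum fun s _ => hDle s ω).trans ?_
    simp
  have hmeas : ∀ {T} {f : Noise → ℝ}, Measurable[past T] f → Measurable f :=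
    fun {T} {f} hf => hf.mono (past.le T) le_rfl
  have hZint : ∀ T, Integrable (Z T) noise := fun T => integrable_of_abs_le (hmeas (hZm T)) (hZb T)
  have hDint : ∀ t, Integrable (fun ω => X t ω / w t ω) noise := fun t =>
    integrable_of_abs_le ((hmeas (hX t)).div (hmeas (hwm t))) (hDle t)
  have horth' : ∀ t (H : Noise → ℝ), Measurable[past t] H → (∃ B, ∀ ω, |H ω| ≤ B) →
      ∫ ω, H ω * (X t ω / w t ω) ∂noise = 0 := fun t H hH ⟨B, hB⟩ => by
    rw [← horth t (fun ω => H ω / w t ω) (hH.div (hwm t)) ⟨B, fun ω => ?_⟩]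
    · exact integral_congr_ae (ae_of_all _ fun ω => by simp only []; ring)
    · rw [abs_div, abs_of_pos (by linarith [hw1 t ω] : 0 < w t ω)]
      exact (div_le_self (abs_nonneg _) (hw1 t ω)).trans (hB ω)
  have hmart : Martingale Z past noise := by
    refine martingale_of_setIntegral_eq_succ (fun T => (hZm T).stronglyMeasurable) hZint
      fun T s hs => ?_
    have h1 : ∀ ω, Z (T + 1) ω = Z T ω + X T ω / w T ω := fun ω => Finset.sum_range_succ _ _
    simp_rw [h1]
    rw [integral_add (hZint T).integrableOn (hDint T).integrableOn, left_eq_add,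
      ← integral_indicator (past.le T s hs),
      ← horth' T (s.indicator fun _ => 1) ?_ ⟨1, fun ω => ?_⟩]
    · refine integral_congr_ae (ae_of_all _ fun ω => ?_)
      by_cases h : ω ∈ s <;> simp [h]
    · exact Measurable.indicator (m := past T) measurable_const hs
    · by_cases h : ω ∈ s <;> simp [h]
  have hZ2int : ∀ T, Integrable (fun ω => Z T ω ^ 2) noise := fun T =>
    integrable_of_abs_le (B := (T : ℝ) ^ 2) ((hmeas (hZm T)).pow_const 2) fun ω => by
      rw [abs_pow]
      exact pow_le_pow_left₀ (abs_nonneg _) (hZb T ω) 2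
  have hwint : ∀ T, Integrable (fun ω => 2 / w T ω) noise := fun T =>
    integrable_of_abs_le (B := 2) (measurable_const.div (hmeas (hwm T))) fun ω => by
      rw [abs_of_nonneg (div_nonneg zero_le_two (by linarith [hw1 T ω]))]
      exact div_le_self zero_le_two (hw1 T ω)
  -- A tick raises `w` by one, and `1 / w ^ 2 ≤ 2 / w - 2 / (w + 1)` because `1 ≤ w`. Adding the
  -- integral of `2 / w` to the second moment thus gives a nonincreasing quantity, equal to `2` at
  -- the start.
  have hL2 : ∀ T, ∫ ω, Z T ω ^ 2 ∂noise + ∫ ω, 2 / w T ω ∂noise ≤ 2 := by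
    intro T
    induction T with
    | zero => simp [hZ_def, hw_def, clockWeight]
    | succ T ih =>
      refine le_trans ?_ ih
      have hcross : Integrable (fun ω => 2 * (Z T ω * (X T ω / w T ω))) noise := by
        have hm : Measurable fun ω => Z T ω * (X T ω / w T ω) :=
          (hmeas (hZm T)).mul ((hmeas (hX T)).div (hmeas (hwm T)))
        refine (integrable_of_abs_le (B := T * 1) hm fun ω => ?_).const_mul 2
        rw [abs_mul]
        exact mul_le_mul (hZb T ω) (hDle T ω) (abs_nonneg _) (Nat.cast_nonneg _)
      have h0 : ∫ ω, 2 * (Z T ω * (X T ω / w T ω)) ∂noise = 0 := by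
        rw [integral_const_mul, horth' T (Z T) (hZm T) ⟨T, hZb T⟩, mul_zero]
      rw [← integral_add (hZ2int _) (hwint _)]
      calc ∫ ω, (Z (T + 1) ω ^ 2 + 2 / w (T + 1) ω) ∂noise
          ≤ ∫ ω, (Z T ω ^ 2 + 2 / w T ω) + 2 * (Z T ω * (X T ω / w T ω)) ∂noise := by
            refine integral_mono ((hZ2int _).add (hwint _))
              (((hZ2int _).add (hwint _)).add hcross) fun ω => ?_
            have h1 : Z (T + 1) ω = Z T ω + X T ω / w T ω := Finset.sum_range_succ _ _
            have h2 : (X T ω / w T ω) ^ 2 ≤ 2 / w T ω - 2 / w (T + 1) ω := by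
              have hwT := hw1 T ω
              rw [hwsucc]
              rcases ha' T ω with h | h
              · have : X T ω = 0 := abs_nonpos_iff.1 (h ▸ hX' T ω)
                simp [h, this]
              · have hX1 : X T ω ^ 2 ≤ 1 := by
                  rw [sq_le_one_iff_abs_le_one]
                  exact h ▸ hX' T ω
                rw [h, div_sub_div _ _ (by linarith) (by linarith), div_pow,
                  div_le_div_iff₀ (by positivity) (by positivity)]
                nlinarith [mul_le_mul_of_nonneg_right hX1
                  (by positivity : 0 ≤ w T ω * (w T ω + 1)), sq_nonneg (w T ω)]
            simp only [h1]
            nlinarith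
        _ = ∫ ω, Z T ω ^ 2 ∂noise + ∫ ω, 2 / w T ω ∂noise := by
            rw [← integral_add (hZ2int _) (hwint _),
              ← add_zero (∫ ω, (Z T ω ^ 2 + 2 / w T ω) ∂noise),
              ← h0]
            exact integral_add ((hZ2int _).add (hwint _)) hcross
  -- The bound is `1 + 2`, from `|z| ≤ 1 + z ^ 2` and the second moment bound.
  have hL1 : ∀ T, eLpNorm (Z T) 1 noise ≤ (3 : NNReal) := fun T => by
    rw [eLpNorm_one_eq_lintegral_enorm, ← ofReal_integral_norm_eq_lintegral_enorm (hZint T)]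
    refine ENNReal.ofReal_le_of_le_toReal ?_
    have h1 : ∫ ω, ‖Z T ω‖ ∂noise ≤ ∫ ω, (1 + Z T ω ^ 2) ∂noise := by
      refine integral_mono (hZint T).norm ((integrable_const _).add (hZ2int T)) fun ω => ?_
      simp only [Real.norm_eq_abs]
      nlinarith [sq_nonneg (|Z T ω| - 1), sq_abs (Z T ω), sq_nonneg (Z T ω)]
    rw [integral_add (integrable_const _) (hZ2int T)] at h1
    have h2 : 0 ≤ ∫ ω, 2 / w T ω ∂noise :=
      integral_nonneg fun ω => div_nonneg zero_le_two (by linarith [hw1 T ω])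
    have h3 := hL2 T
    simp only [integral_const, probReal_univ, smul_eq_mul, mul_one] at h1
    simp only [ENNReal.coe_toReal, NNReal.coe_ofNat]
    linarith
  filter_upwards [hmart.submartingale.exists_ae_tendsto_of_bdd hL1] with ω ⟨z, hz⟩ hN
  have hwN : Tendsto (fun T => w T ω) atTop atTop := tendsto_atTop_add_const_left _ _ hN
  have hwmono : Monotone fun T => w T ω := monotone_nat_of_le_succ fun T => by
    simp only [hwsucc]
    linarith [ha0 T ω]
  have hkron := tendsto_sum_mul_div hwmono hwN hz
  have hratio : Tendsto (fun T => w T ω / ∑ t ∈ Finset.range T, a t ω) atTop (𝓝 1) := by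
    have : Tendsto (fun T => 1 / (∑ t ∈ Finset.range T, a t ω) + 1) atTop (𝓝 (0 + 1)) :=
      (hN.const_div_atTop _).add_const 1
    rw [zero_add] at this
    refine this.congr' ?_
    filter_upwards [hN.eventually_gt_atTop 0] with T hT
    simp only [hw_def, clockWeight]
    field_simp
  have := hkron.mul hratio
  rw [zero_mul] at this
  refine this.congr fun T => ?_
  have hpos : w T ω ≠ 0 := by linarith [hw1 T ω]
  rw [div_mul_div_cancel₀ hpos]
  congr 1
  refine Finset.sum_congr rfl fun t _ => ?_
  exact mul_div_cancel₀ _ (by linarith [hw1 t ω])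

/-! ## The controlled process -/

/-- Conditional probability of a transmission at time `k`, given the history. -/
def txProb (r : ℝ) (f : Policy) (ω : Noise) (k : ℕ) : ℝ :=
  f k (history r f ω k).1 (history r f ω k).2

/-- Indicator of a successful transmission at time `k`. -/
def success (r : ℝ) (f : Policy) (ω : Noise) (k : ℕ) : ℝ :=
  action r f ω k * below r (ω k).2

theorem history_succ (r : ℝ) (f : Policy) (ω : Noise) (k : ℕ) :
    history r f ω (k + 1) =
      (Fin.snoc (α := fun _ => ℕ) (history r f ω k).1
        (if decide (((ω k).1 : ℝ) < txProb r f ω k) = true ∧ ((ω k).2 : ℝ) < r then 0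
          else tau r f ω k + 1),
      Fin.snoc (α := fun _ => Bool) (history r f ω k).2
        (decide (((ω k).1 : ℝ) < txProb r f ω k))) := rfl

theorem action_eq_below (r : ℝ) (f : Policy) (ω : Noise) (k : ℕ) :
    action r f ω k = below (txProb r f ω k) (ω k).1 := by
  rw [action, history_succ]
  simp [below]

theorem tau_zero (r : ℝ) (f : Policy) (ω : Noise) : tau r f ω 0 = 0 := rfl

theorem tau_succ (r : ℝ) (f : Policy) (ω : Noise) (k : ℕ) :
    tau r f ω (k + 1) = if success r f ω k = 1 then 0 else tau r f ω k + 1 := by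
  rw [tau, history_succ, success, action_eq_below]
  simp only [Fin.snoc_last, below, decide_eq_true_eq]
  by_cases h1 : ((ω k).1 : ℝ) < txProb r f ω k <;> by_cases h2 : ((ω k).2 : ℝ) < r <;>
    simp [h1, h2]

theorem action_eq_zero_or_one (r : ℝ) (f : Policy) (ω : Noise) (k : ℕ) :
    action r f ω k = 0 ∨ action r f ω k = 1 := by
  rw [action]
  split_ifs <;> simp

theorem success_eq_zero_or_one (r : ℝ) (f : Policy) (ω : Noise) (k : ℕ) :
    success r f ω k = 0 ∨ success r f ω k = 1 := by
  rw [success, below]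
  rcases action_eq_zero_or_one r f ω k with h | h <;> rw [h] <;> split_ifs <;> simp

theorem tau_le (r : ℝ) (f : Policy) (ω : Noise) (k : ℕ) : tau r f ω k ≤ k := by
  induction k with
  | zero => exact (tau_zero r f ω).le
  | succ k ih =>
    rw [tau_succ]
    split_ifs <;> omega

/-- Being affine in the success indicator, this lets an expectation replace the indicator by its
conditional probability. -/
theorem apply_tau_succ (F : ℕ → ℝ) (r : ℝ) (f : Policy) (ω : Noise) (k : ℕ) :
    F (tau r f ω (k + 1)) =
      F (tau r f ω k + 1) + (F 0 - F (tau r f ω k + 1)) * success r f ω k := by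
  rw [tau_succ]
  rcases success_eq_zero_or_one r f ω k with h | h <;> simp [h]

/-! ## Measurability -/

/-- Histories take countably many values, so measurability is checked in the fresh noise for each
fixed history. -/
theorem measurable_history (r : ℝ) (f : Policy) (k : ℕ) :
    Measurable[past k] fun ω => history r f ω k := by
  induction k with
  | zero => exact measurable_const
  | succ k ih =>
    let step : ((Fin (k + 1) → ℕ) × (Fin k → Bool)) × (unitInterval × unitInterval) →
        (Fin (k + 2) → ℕ) × (Fin (k + 1) → Bool) := fun p =>
      (Fin.snoc (α := fun _ => ℕ) p.1.1
        (if decide ((p.2.1 : ℝ) < f k p.1.1 p.1.2) = true ∧ decide ((p.2.2 : ℝ) < r) = true then 0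
          else p.1.1 (Fin.last k) + 1),
      Fin.snoc (α := fun _ => Bool) p.1.2 (decide ((p.2.1 : ℝ) < f k p.1.1 p.1.2)))
    have hstep : Measurable step := by
      refine measurable_from_prod_countable_right fun y => ?_
      have h1 : Measurable fun z : unitInterval × unitInterval =>
          (decide ((z.1 : ℝ) < f k y.1 y.2), decide ((z.2 : ℝ) < r)) := by
        refine Measurable.prodMk (measurable_to_bool ?_) (measurable_to_bool ?_)
        · simpa [Set.preimage] using measurableSet_lt
            (measurable_subtype_coe.comp measurable_fst) measurable_const
        · simpa [Set.preimage] using measurableSet_lt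
            (measurable_subtype_coe.comp measurable_snd) measurable_const
      exact (measurable_of_countable fun d : Bool × Bool =>
        ((Fin.snoc (α := fun _ => ℕ) y.1
          (if d.1 = true ∧ d.2 = true then 0 else y.1 (Fin.last k) + 1),
          Fin.snoc (α := fun _ => Bool) y.2 d.1) :
            (Fin (k + 2) → ℕ) × (Fin (k + 1) → Bool))).comp h1
    have h2 : (fun ω => history r f ω (k + 1)) = fun ω => step (history r f ω k, ω k) := by
      funext ω
      rw [history_succ]
      simp only [step, decide_eq_true_eq]
      rfl
    rw [h2]
    exact hstep.comp ((ih.mono (past.mono k.le_succ) le_rfl).prodMk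
      (measurable_past_eval k.lt_succ_self))

theorem measurable_comp_history {Γ : Type*} [MeasurableSpace Γ] (r : ℝ) (f : Policy) (k : ℕ)
    (φ : (Fin (k + 1) → ℕ) × (Fin k → Bool) → Γ) :
    Measurable[past k] fun ω => φ (history r f ω k) :=
  (measurable_of_countable φ).comp (measurable_history r f k)

theorem measurable_comp_tau {Γ : Type*} [MeasurableSpace Γ] (r : ℝ) (f : Policy) (k : ℕ)
    (F : ℕ → Γ) : Measurable[past k] fun ω => F (tau r f ω k) :=
  measurable_comp_history r f k fun y => F (y.1 (Fin.last k))

theorem measurable_txProb (r : ℝ) (f : Policy) (k : ℕ) :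
    Measurable[past k] fun ω => txProb r f ω k :=
  measurable_comp_history r f k fun y => f k y.1 y.2

theorem measurable_action (r : ℝ) (f : Policy) (k : ℕ) :
    Measurable[past (k + 1)] fun ω => action r f ω k :=
  measurable_comp_history r f (k + 1) fun y => if y.2 (Fin.last k) = true then (1 : ℝ) else 0

theorem measurable_success (r : ℝ) (f : Policy) (k : ℕ) :
    Measurable[past (k + 1)] fun ω => success r f ω k :=
  (measurable_action r f k).mul ((measurable_below (Γ := unitInterval × unitInterval)
    (p := fun _ => r) measurable_const measurable_snd).comp
      (measurable_past_eval k.lt_succ_self))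

theorem action_mem (r : ℝ) (f : Policy) (ω : Noise) (k : ℕ) :
    action r f ω k ∈ Set.Icc (0 : ℝ) 1 := by
  rcases action_eq_zero_or_one r f ω k with h | h <;> simp [h]

theorem success_mem (r : ℝ) (f : Policy) (ω : Noise) (k : ℕ) :
    success r f ω k ∈ Set.Icc (0 : ℝ) 1 := by
  rcases success_eq_zero_or_one r f ω k with h | h <;> simp [h]

theorem Admissible.txProb_mem {f : Policy} (hf : Admissible f) (r : ℝ) (ω : Noise) (k : ℕ) :
    txProb r f ω k ∈ Set.Icc (0 : ℝ) 1 := hf k _ _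

/-! ## Orthogonality of innovations to the past -/

theorem integral_mul_innovation (r : ℝ) (f : Policy) {k : ℕ}
    {φ : ((Fin (k + 1) → ℕ) × (Fin k → Bool)) × (unitInterval × unitInterval) → ℝ}
    (hφ : ∀ y, Measurable fun z => φ (y, z)) (hφ1 : ∀ y, |φ y| ≤ 1)
    (hφ0 : ∀ y, ∫ z : unitInterval × unitInterval, φ (y, z) = 0)
    {H : Noise → ℝ} (hH : Measurable[past k] H) (hHb : ∃ B, ∀ ω, |H ω| ≤ B) :
    ∫ ω, H ω * φ (history r f ω k, ω k) ∂noise = 0 := by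
  obtain ⟨B, hB⟩ := hHb
  have hφm : Measurable φ := measurable_from_prod_countable_right hφ
  have hY : Measurable[past k] fun ω => (H ω, history r f ω k) :=
    hH.prodMk (measurable_history r f k)
  have hm : Measurable fun ω => H ω * φ (history r f ω k, ω k) :=
    (hH.mono (past.le k) le_rfl).mul (hφm.comp
      (((measurable_history r f k).mono (past.le k) le_rfl).prodMk (measurable_pi_apply k)))
  have := integral_step (k := k) hY
    (ψ := fun p : (ℝ × ((Fin (k + 1) → ℕ) × (Fin k → Bool))) × (unitInterval × unitInterval) =>
      p.1.1 * φ (p.1.2, p.2))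
    ((measurable_fst.comp measurable_fst).mul (hφm.comp
      ((measurable_snd.comp measurable_fst).prodMk measurable_snd)))
    (integrable_of_abs_le (B := B * 1) hm fun ω => by
      rw [abs_mul]
      exact mul_le_mul (hB ω) (hφ1 _) (abs_nonneg _) ((abs_nonneg _).trans (hB ω)))
  rw [this]
  simp [integral_const_mul, hφ0]

theorem abs_sub_le_one {x y : ℝ} (hx : x ∈ Set.Icc (0 : ℝ) 1) (hy : y ∈ Set.Icc (0 : ℝ) 1) :
    |x - y| ≤ 1 :=
  abs_le.2 ⟨by linarith [hx.1, hy.2], by linarith [hx.2, hy.1]⟩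

theorem mul_mem_unit {x y : ℝ} (hx : x ∈ Set.Icc (0 : ℝ) 1) (hy : y ∈ Set.Icc (0 : ℝ) 1) :
    x * y ∈ Set.Icc (0 : ℝ) 1 :=
  ⟨mul_nonneg hx.1 hy.1, mul_le_one₀ hx.2 hy.1 hy.2⟩

theorem Admissible.integral_mul_success_sub {f : Policy} (hf : Admissible f) {r : ℝ}
    (hr : r ∈ Set.Icc (0 : ℝ) 1) (k : ℕ) {H : Noise → ℝ} (hH : Measurable[past k] H)
    (hHb : ∃ B, ∀ ω, |H ω| ≤ B) :
    ∫ ω, H ω * (success r f ω k - r * txProb r f ω k) ∂noise = 0 := by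
  rw [← integral_mul_innovation r f (k := k)
    (φ := fun p => below (f k p.1.1 p.1.2) p.2.1 * below r p.2.2 - r * f k p.1.1 p.1.2)
    (fun y => ?_) (fun y => ?_) (fun y => ?_) hH hHb]
  · simp only [success, action_eq_below, txProb]
  · exact ((measurable_below (p := fun _ => f k y.1 y.2) measurable_const measurable_fst).mul
      (measurable_below (p := fun _ => r) measurable_const measurable_snd)).sub
        (measurable_const (a := r * f k y.1 y.2))
  · exact abs_sub_le_one (mul_mem_unit (below_mem _ _) (below_mem _ _)) (mul_mem_unit hr (hf _ _ _))
  · have hi : Integrable fun z : unitInterval × unitInterval =>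
        below (f k y.1 y.2) z.1 * below r z.2 :=
      Integrable.of_bound ((measurable_below measurable_const measurable_fst).mul
        (measurable_below measurable_const measurable_snd)).aestronglyMeasurable 1
        (ae_of_all _ fun z => by
          have := mul_mem_unit (below_mem (f k y.1 y.2) z.1) (below_mem r z.2)
          rw [Real.norm_eq_abs, abs_of_nonneg this.1]
          exact this.2)
    change ∫ z : unitInterval × unitInterval,
      (below (f k y.1 y.2) z.1 * below r z.2 - r * f k y.1 y.2) = 0
    rw [integral_sub hi (integrable_const _), integral_below_mul (hf _ _ _) hr]
    simp [mul_comm]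

/-- The channel factor has mean zero by itself. Centring by the decision makes the innovation vanish
when nothing is sent, as a clock of transmissions requires. -/
theorem integral_mul_success_sub_action (f : Policy) {r : ℝ}
    (hr : r ∈ Set.Icc (0 : ℝ) 1) (k : ℕ) {H : Noise → ℝ} (hH : Measurable[past k] H)
    (hHb : ∃ B, ∀ ω, |H ω| ≤ B) :
    ∫ ω, H ω * (success r f ω k - r * action r f ω k) ∂noise = 0 := by
  have hm1 : Measurable fun z : unitInterval × unitInterval => below r z.2 :=
    measurable_below measurable_const measurable_snd
  rw [← integral_mul_innovation r f (k := k)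
    (φ := fun p => below (f k p.1.1 p.1.2) p.2.1 * (below r p.2.2 - r))
    (fun y => ?_) (fun y => ?_) (fun y => ?_) hH hHb]
  · simp only [success, action_eq_below, txProb]
    refine integral_congr_ae (ae_of_all _ fun ω => by simp only []; ring)
  · exact (measurable_below (p := fun _ => f k y.1 y.2) measurable_const measurable_fst).mul
      (hm1.sub measurable_const)
  · rw [abs_mul, abs_of_nonneg (below_mem _ _).1]
    exact mul_le_one₀ (below_mem _ _).2 (abs_nonneg _) (abs_sub_le_one (below_mem _ _) hr)
  · rw [Measure.volume_eq_prod,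
      integral_prod_mul (fun u => below (f k y.1 y.2) u) (fun u => below r u - r)]
    have hi : Integrable (below r) :=
      Integrable.of_bound (measurable_below (p := fun _ => r) measurable_const
        measurable_id).aestronglyMeasurable 1 (ae_of_all _ fun z => by
          rw [Real.norm_eq_abs, abs_of_nonneg (below_mem r z).1]
          exact (below_mem r z).2)
    rw [integral_sub hi (integrable_const _), integral_below hr]
    simp

/-! ## Expected occupation of holding times -/

theorem integrable_comp_tau (r : ℝ) (f : Policy) (k : ℕ) (F : ℕ → ℝ) :
    Integrable (fun ω => F (tau r f ω k)) noise := by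
  refine integrable_of_abs_le (B := ∑ j ∈ Finset.range (k + 1), |F j|)
    ((measurable_comp_tau r f k F).mono (past.le k) le_rfl) fun ω => ?_
  exact Finset.single_le_sum (f := fun j => |F j|) (fun _ _ => abs_nonneg _)
    (Finset.mem_range.2 (Nat.lt_succ_of_le (tau_le r f ω k)))

theorem exists_abs_comp_tau_le (r : ℝ) (f : Policy) (k : ℕ) (F : ℕ → ℝ) :
    ∃ B, ∀ ω, |F (tau r f ω k)| ≤ B :=
  ⟨∑ j ∈ Finset.range (k + 1), |F j|, fun ω =>
    Finset.single_le_sum (f := fun j => |F j|) (fun _ _ => abs_nonneg _)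
      (Finset.mem_range.2 (Nat.lt_succ_of_le (tau_le r f ω k)))⟩

theorem integrable_success (r : ℝ) (f : Policy) (k : ℕ) :
    Integrable (fun ω => success r f ω k) noise :=
  integrable_of_abs_le (B := 1) ((measurable_success r f k).mono (past.le _) le_rfl) fun ω => by
    rw [abs_of_nonneg (success_mem r f ω k).1]
    exact (success_mem r f ω k).2

theorem integrable_action (r : ℝ) (f : Policy) (k : ℕ) :
    Integrable (fun ω => action r f ω k) noise :=
  integrable_of_abs_le (B := 1) ((measurable_action r f k).mono (past.le _) le_rfl) fun ω => by
    rw [abs_of_nonneg (action_mem r f ω k).1]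
    exact (action_mem r f ω k).2

theorem Admissible.integrable_mul_txProb {f : Policy} (hf : Admissible f) (r : ℝ) (k : ℕ)
    (F : ℕ → ℝ) : Integrable (fun ω => F (tau r f ω k) * (r * txProb r f ω k)) noise := by
  refine (integrable_comp_tau r f k F).mul_bdd (c := |r|)
    (((measurable_txProb r f k).mono (past.le k) le_rfl).const_mul r).aestronglyMeasurable
    (ae_of_all _ fun ω => ?_)
  have h := hf.txProb_mem r ω k
  rw [Real.norm_eq_abs, abs_mul, abs_of_nonneg h.1]
  exact mul_le_of_le_one_right (abs_nonneg _) h.2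

theorem Admissible.integral_tau_succ {f : Policy} (hf : Admissible f) {r : ℝ}
    (hr : r ∈ Set.Icc (0 : ℝ) 1) (k : ℕ) (F : ℕ → ℝ) :
    ∫ ω, F (tau r f ω (k + 1)) ∂noise =
      ∫ ω, (F (tau r f ω k + 1) +
        (F 0 - F (tau r f ω k + 1)) * (r * txProb r f ω k)) ∂noise := by
  have h := hf.integral_mul_success_sub hr k
    (measurable_comp_tau r f k fun n => F 0 - F (n + 1))
    (exists_abs_comp_tau_le r f k fun n => F 0 - F (n + 1))
  have h1 := hf.integrable_mul_txProb r k fun n => F 0 - F (n + 1)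
  have h2 := integrable_comp_tau r f k fun n => F (n + 1)
  have h3 : Integrable (fun ω => F (tau r f ω k + 1) +
      (F 0 - F (tau r f ω k + 1)) * (r * txProb r f ω k)) noise := h2.add h1
  rw [← sub_eq_zero, ← integral_sub (integrable_comp_tau r f (k + 1) F) h3, ← h]
  refine integral_congr_ae (ae_of_all _ fun ω => ?_)
  simp only [apply_tau_succ F r f ω k]
  ring

/-- Indicator of `n = j`. -/
def eqInd (j n : ℕ) : ℝ := if n = j then 1 else 0

/-- Indicator of `j ≤ n`. -/
def geInd (j n : ℕ) : ℝ := if j ≤ n then 1 else 0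

theorem eqInd_mem (j n : ℕ) : eqInd j n ∈ Set.Icc (0 : ℝ) 1 := by
  unfold eqInd
  split_ifs <;> simp

theorem geInd_mem (j n : ℕ) : geInd j n ∈ Set.Icc (0 : ℝ) 1 := by
  unfold geInd
  split_ifs <;> simp

theorem eqInd_add_geInd (j n : ℕ) : eqInd j n + geInd (j + 1) n = geInd j n := by
  unfold eqInd geInd
  split_ifs <;> first | omega | simp

theorem sum_eqInd_add_geInd (K n : ℕ) :
    ∑ j ∈ Finset.range K, eqInd j n + geInd K n = 1 := by
  induction K with
  | zero => simp [geInd]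
  | succ K ih => rw [Finset.sum_range_succ, add_assoc, eqInd_add_geInd, ih]

@[simp] theorem eqInd_succ_succ (j n : ℕ) : eqInd (j + 1) (n + 1) = eqInd j n := by simp [eqInd]

@[simp] theorem geInd_succ_succ (j n : ℕ) : geInd (j + 1) (n + 1) = geInd j n := by simp [geInd]

@[simp] theorem eqInd_succ_zero (j : ℕ) : eqInd (j + 1) 0 = 0 := by simp [eqInd]

@[simp] theorem geInd_succ_zero (j : ℕ) : geInd (j + 1) 0 = 0 := by simp [geInd]

@[simp] theorem eqInd_zero_zero : eqInd 0 0 = 1 := by simp [eqInd]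

@[simp] theorem eqInd_zero_succ (n : ℕ) : eqInd 0 (n + 1) = 0 := by simp [eqInd]

theorem sum_comp_eq_sum_eqInd (c : ℕ → ℝ) {x : ℕ → ℕ} (hx : ∀ k, x k ≤ k) (T : ℕ) :
    ∑ k ∈ Finset.range T, c (x k) =
      ∑ j ∈ Finset.range T, c j * ∑ k ∈ Finset.range T, eqInd j (x k) := by
  simp_rw [Finset.mul_sum]
  rw [Finset.sum_comm]
  refine Finset.sum_congr rfl fun k hk => ?_
  rw [Finset.sum_eq_single (x k)]
  · simp [eqInd]
  · intro j _ hj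
    simp [eqInd, hj.symm]
  · intro h
    exact absurd (Finset.mem_range.2 ((hx k).trans_lt (Finset.mem_range.1 hk))) h

theorem ofReal_sum_range_mul {c p : ℕ → ℝ} (hc : ∀ j, 0 ≤ c j) (hp : ∀ j, 0 ≤ p j) {T : ℕ}
    (hT : ∀ j, T ≤ j → p j = 0) :
    ENNReal.ofReal (∑ j ∈ Finset.range T, c j * p j) =
      ∑' j, ENNReal.ofReal (c j) * ENNReal.ofReal (p j) := by
  rw [ENNReal.ofReal_sum_of_nonneg fun j _ => mul_nonneg (hc j) (hp j),
    tsum_eq_sum (s := Finset.range T)]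
  · exact Finset.sum_congr rfl fun j _ => ENNReal.ofReal_mul (hc j)
  · intro j hj
    rw [hT j (by simpa using hj)]
    simp

theorem sum_eqInd_eq_zero {x : ℕ → ℕ} (hx : ∀ k, x k ≤ k) {T j : ℕ} (hj : T ≤ j) :
    ∑ k ∈ Finset.range T, eqInd j (x k) = 0 := by
  refine Finset.sum_eq_zero fun k hk => if_neg ?_
  have := hx k
  have := Finset.mem_range.1 hk
  omega

/-- Expected time average of `F (τ)` up to time `T`. -/
def meanAvg (r : ℝ) (f : Policy) (F : ℕ → ℝ) (T : ℕ) : ℝ :=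
  1 / (T : ℝ) * ∑ k ∈ Finset.range T, ∫ ω, F (tau r f ω k) ∂noise

theorem integral_sum_comp_tau (r : ℝ) (f : Policy) (F : ℕ → ℝ) (T : ℕ) :
    1 / (T : ℝ) * ∫ ω, ∑ k ∈ Finset.range T, F (tau r f ω k) ∂noise = meanAvg r f F T := by
  rw [meanAvg, integral_finsetSum _ fun k _ => integrable_comp_tau r f k F]

theorem meanAvg_nonneg (r : ℝ) (f : Policy) {F : ℕ → ℝ} (hF : ∀ n, 0 ≤ F n) (T : ℕ) :
    0 ≤ meanAvg r f F T :=
  mul_nonneg (by positivity) (Finset.sum_nonneg fun _ _ => integral_nonneg fun _ => hF _)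

theorem meanAvg_eq_sum (r : ℝ) (f : Policy) (c : ℕ → ℝ) (T : ℕ) :
    meanAvg r f c T = ∑ j ∈ Finset.range T, c j * meanAvg r f (eqInd j) T := by
  simp_rw [← integral_sum_comp_tau]
  rw [integral_congr_ae (ae_of_all _ fun ω => sum_comp_eq_sum_eqInd c (tau_le r f ω) T),
    integral_finsetSum _ fun j _ => (integrable_finsetSum _ fun k _ =>
      integrable_comp_tau r f k (eqInd j)).const_mul _, Finset.mul_sum]
  refine Finset.sum_congr rfl fun j _ => ?_
  rw [integral_const_mul]
  ring

theorem ofReal_meanAvg (r : ℝ) (f : Policy) {c : ℕ → ℝ} (hc : ∀ j, 0 ≤ c j) (T : ℕ) :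
    ENNReal.ofReal (meanAvg r f c T) =
      ∑' j, ENNReal.ofReal (c j) * ENNReal.ofReal (meanAvg r f (eqInd j) T) := by
  rw [meanAvg_eq_sum]
  refine ofReal_sum_range_mul hc (fun j => meanAvg_nonneg r f (fun n => (eqInd_mem j n).1) T)
    fun j hj => ?_
  rw [← integral_sum_comp_tau]
  simp [sum_eqInd_eq_zero (tau_le r f _) hj]

theorem meanAvg_add (r : ℝ) (f : Policy) (F G : ℕ → ℝ) (T : ℕ) :
    meanAvg r f (fun n => F n + G n) T = meanAvg r f F T + meanAvg r f G T := by
  simp only [meanAvg]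
  rw [← mul_add, ← Finset.sum_add_distrib]
  congr 1
  exact Finset.sum_congr rfl fun k _ =>
    integral_add (integrable_comp_tau r f k F) (integrable_comp_tau r f k G)

theorem meanAvg_const_mul (r : ℝ) (f : Policy) (F : ℕ → ℝ) (a : ℝ) (T : ℕ) :
    meanAvg r f (fun n => a * F n) T = a * meanAvg r f F T := by
  simp only [meanAvg, integral_const_mul, ← Finset.mul_sum]
  ring

theorem meanAvg_sum {ι : Type*} (r : ℝ) (f : Policy) (s : Finset ι) (F : ι → ℕ → ℝ) (T : ℕ) :
    meanAvg r f (fun n => ∑ i ∈ s, F i n) T = ∑ i ∈ s, meanAvg r f (F i) T := by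
  simp only [meanAvg]
  rw [← Finset.mul_sum, Finset.sum_comm]
  congr 1
  exact Finset.sum_congr rfl fun k _ =>
    integral_finsetSum _ fun i _ => integrable_comp_tau r f k (F i)

theorem meanAvg_one (r : ℝ) (f : Policy) {T : ℕ} (hT : T ≠ 0) : meanAvg r f (fun _ => 1) T = 1 := by
  have : (T : ℝ) ≠ 0 := by exact_mod_cast hT
  simp [meanAvg, this]

theorem meanAvg_mono (r : ℝ) (f : Policy) {F G : ℕ → ℝ} (h : ∀ n, F n ≤ G n) (T : ℕ) :
    meanAvg r f F T ≤ meanAvg r f G T :=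
  mul_le_mul_of_nonneg_left (Finset.sum_le_sum fun k _ =>
    integral_mono (integrable_comp_tau r f k F) (integrable_comp_tau r f k G) fun _ => h _)
    (by positivity)

theorem sum_eqInd_add_geInd_meanAvg (r : ℝ) (f : Policy) (K : ℕ) {T : ℕ} (hT : T ≠ 0) :
    ∑ j ∈ Finset.range K, meanAvg r f (eqInd j) T + meanAvg r f (geInd K) T = 1 := by
  rw [← meanAvg_sum, ← meanAvg_add, ← meanAvg_one r f hT]
  simp_rw [sum_eqInd_add_geInd]

theorem tendsto_avg_telescope {y : ℕ → ℝ} (hy : ∀ k, y k ∈ Set.Icc (0 : ℝ) 1) :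
    Tendsto (fun T : ℕ => 1 / (T : ℝ) * ∑ k ∈ Finset.range T, (y (k + 1) - y k)) atTop (𝓝 0) := by
  simp_rw [Finset.sum_range_sub]
  refine squeeze_zero_norm (fun T => ?_) tendsto_one_div_atTop_nhds_zero_nat
  rw [norm_mul, Real.norm_of_nonneg (by positivity : (0 : ℝ) ≤ 1 / T)]
  exact mul_le_of_le_one_right (by positivity) (abs_sub_le_one (hy T) (hy 0))

theorem integral_comp_tau_mem (r : ℝ) (f : Policy) {F : ℕ → ℝ}
    (hF : ∀ n, F n ∈ Set.Icc (0 : ℝ) 1) (k : ℕ) :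
    ∫ ω, F (tau r f ω k) ∂noise ∈ Set.Icc (0 : ℝ) 1 := by
  refine ⟨integral_nonneg fun ω => (hF _).1, ?_⟩
  have := integral_mono (integrable_comp_tau r f k F) (integrable_const (1 : ℝ)) fun ω => (hF _).2
  simpa using this

/-! ## Stationary rules -/

theorem admissible_stationary {g : ℕ → ℝ} (hg : ∀ j, g j ∈ Set.Icc (0 : ℝ) 1) :
    Admissible (stationary g) := fun _ _ _ => hg _

theorem txProb_stationary (r : ℝ) (g : ℕ → ℝ) (ω : Noise) (k : ℕ) :
    txProb r (stationary g) ω k = g (tau r (stationary g) ω k) := rfl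

theorem integral_eqInd_succ_stationary {r : ℝ} (hr : r ∈ Set.Icc (0 : ℝ) 1) {g : ℕ → ℝ}
    (hg : ∀ j, g j ∈ Set.Icc (0 : ℝ) 1) (j k : ℕ) :
    ∫ ω, eqInd (j + 1) (tau r (stationary g) ω (k + 1)) ∂noise =
      (∫ ω, eqInd j (tau r (stationary g) ω k) ∂noise) * (1 - r * g j) := by
  rw [(admissible_stationary hg).integral_tau_succ hr, ← integral_mul_const]
  refine integral_congr_ae (ae_of_all _ fun ω => ?_)
  simp only [eqInd_succ_succ, eqInd_succ_zero, txProb_stationary]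
  unfold eqInd
  split_ifs with h
  · rw [h]; ring
  · ring

theorem integral_geInd_succ_stationary {r : ℝ} (hr : r ∈ Set.Icc (0 : ℝ) 1) {g : ℕ → ℝ}
    (hg : ∀ j, g j ∈ Set.Icc (0 : ℝ) 1) {K : ℕ} (hK : ∀ j, K ≤ j → g j = 1) (k : ℕ) :
    ∫ ω, geInd (K + 1) (tau r (stationary g) ω (k + 1)) ∂noise =
      (∫ ω, geInd K (tau r (stationary g) ω k) ∂noise) * (1 - r) := by
  rw [(admissible_stationary hg).integral_tau_succ hr, ← integral_mul_const]
  refine integral_congr_ae (ae_of_all _ fun ω => ?_)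
  simp only [geInd_succ_succ, geInd_succ_zero, txProb_stationary]
  unfold geInd
  split_ifs with h
  · rw [hK _ h]; ring
  · ring

/-- Averaging the one-step identities over time leaves a telescoping error of order `1 / T`. Cesàro
averages also cover periodic chains, which occur for `r = 1`. -/
theorem tendsto_meanAvg_stationary {r : ℝ} (hr : r ∈ Set.Ioc (0 : ℝ) 1) {g : ℕ → ℝ}
    (hg : ∀ j, g j ∈ Set.Icc (0 : ℝ) 1) {K : ℕ} (hK : ∀ j, K ≤ j → g j = 1) (j : ℕ) :
    Tendsto (fun T => meanAvg r (stationary g) (eqInd j) T) atTop (𝓝 (occupation r g K j)) := by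
  have hr' : r ∈ Set.Icc (0 : ℝ) 1 := ⟨hr.1.le, hr.2⟩
  refine tendsto_occupation hr hg (p := fun T j => meanAvg r (stationary g) (eqInd j) T)
    (u := fun T => meanAvg r (stationary g) (geInd K) T) ?_ (fun j => ?_) ?_ j
  · filter_upwards [eventually_ne_atTop 0] with T hT
    exact sum_eqInd_add_geInd_meanAvg _ _ _ hT
  · have := (tendsto_avg_telescope (integral_comp_tau_mem r (stationary g) (eqInd_mem (j + 1)))).neg
    rw [neg_zero] at this
    refine this.congr fun T => ?_
    simp_rw [integral_eqInd_succ_stationary hr' hg, meanAvg, Finset.sum_sub_distrib,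
      ← Finset.sum_mul]
    ring
  · have := tendsto_avg_telescope (integral_comp_tau_mem r (stationary g) (geInd_mem (K + 1)))
    refine this.congr fun T => ?_
    have h : meanAvg r (stationary g) (eqInd K) T = meanAvg r (stationary g) (geInd K) T -
        meanAvg r (stationary g) (geInd (K + 1)) T := by
      rw [eq_sub_iff_add_eq, ← meanAvg_add]
      simp_rw [eqInd_add_geInd]
    rw [h]
    simp_rw [integral_geInd_succ_stationary hr' hg hK, meanAvg, Finset.sum_sub_distrib,
      ← Finset.sum_mul]
    ring

/-- Being in state `j` requires `j` steps without success from state `0`; the bound is uniform in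
time and so dominates the averages. -/
theorem integral_eqInd_le_reach {r : ℝ} (hr : r ∈ Set.Ioc (0 : ℝ) 1) {g : ℕ → ℝ}
    (hg : ∀ j, g j ∈ Set.Icc (0 : ℝ) 1) (j k : ℕ) :
    ∫ ω, eqInd j (tau r (stationary g) ω k) ∂noise ≤ reach r g j := by
  induction j generalizing k with
  | zero =>
    rw [reach_zero]
    exact (integral_comp_tau_mem r (stationary g) (eqInd_mem 0) k).2
  | succ j ih =>
    cases k with
    | zero => simpa [tau_zero] using reach_nonneg hr hg (j + 1)
    | succ k =>
      rw [integral_eqInd_succ_stationary ⟨hr.1.le, hr.2⟩ hg, reach_succ]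
      exact mul_le_mul_of_nonneg_right (ih k) (factor_mem hr (hg j)).1

theorem meanAvg_eqInd_le_reach {r : ℝ} (hr : r ∈ Set.Ioc (0 : ℝ) 1) {g : ℕ → ℝ}
    (hg : ∀ j, g j ∈ Set.Icc (0 : ℝ) 1) (j T : ℕ) :
    meanAvg r (stationary g) (eqInd j) T ≤ reach r g j := by
  rcases eq_or_ne T 0 with rfl | hT
  · simpa [meanAvg] using reach_nonneg hr hg j
  · have hT' : (0 : ℝ) < T := by exact_mod_cast Nat.pos_of_ne_zero hT
    rw [meanAvg, one_div, inv_mul_le_iff₀ hT']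
    refine (Finset.sum_le_sum fun k _ => integral_eqInd_le_reach hr hg j k).trans ?_
    simp

theorem Je_stationary {c : ℕ → ℝ} (hc : ∀ j, 0 ≤ c j) {r : ℝ} (hr : r ∈ Set.Ioc (0 : ℝ) 1)
    {g : ℕ → ℝ} (hg : ∀ j, g j ∈ Set.Icc (0 : ℝ) 1) {K : ℕ} (hK : ∀ j, K ≤ j → g j = 1) :
    Je c r (stationary g) = (avgCost c r g K : EReal) := by
  have h : Tendsto (fun T => ENNReal.ofReal (meanAvg r (stationary g) c T)) atTop
      (𝓝 (avgCost c r g K)) := by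
    simp_rw [ofReal_meanAvg r (stationary g) hc]
    refine tendsto_tsum_mul_of_dominated (fun _ => ENNReal.ofReal_ne_top)
      (fun j => ENNReal.tendsto_ofReal (tendsto_meanAvg_stationary hr hg hK j))
      (β := fun j => ENNReal.ofReal ((1 - r) ^ (j - K))) ?_ fun hV =>
        tsum_reach_bound_ne_top (tsum_geometric_ne_top_of_avgCost_ne_top hr hg hV K)
    exact Eventually.of_forall fun T j => ENNReal.ofReal_le_ofReal
      ((meanAvg_eqInd_le_reach hr hg j T).trans (reach_le_pow hr hg hK j))
  have h2 := ((continuous_coe_ennreal_ereal.tendsto _).comp h).limsup_eq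
  rw [← h2, Je]
  congr 1
  funext T
  rw [integral_sum_comp_tau, Function.comp_apply, EReal.coe_ennreal_ofReal,
    max_eq_left (meanAvg_nonneg r _ hc T)]

/-- After the initial time, visits to `0` are exactly successes. This links transmission rate and
occupation of `0`. -/
theorem integral_success (f : Policy) {r : ℝ}
    (hr : r ∈ Set.Icc (0 : ℝ) 1) (k : ℕ) :
    ∫ ω, eqInd 0 (tau r f ω (k + 1)) ∂noise = r * ∫ ω, action r f ω k ∂noise := by
  have h := integral_mul_success_sub_action f hr k (H := fun _ => 1) measurable_const
    ⟨1, fun _ => by simp⟩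
  simp only [one_mul] at h
  rw [integral_sub (integrable_success r f k) ((integrable_action r f k).const_mul r), sub_eq_zero,
    integral_const_mul] at h
  rw [← h]
  refine integral_congr_ae (ae_of_all _ fun ω => ?_)
  simp [apply_tau_succ (eqInd 0)]

theorem sum_integral_eqInd_zero (f : Policy) {r : ℝ}
    (hr : r ∈ Set.Icc (0 : ℝ) 1) (T : ℕ) :
    r * ∫ ω, ∑ k ∈ Finset.range T, action r f ω k ∂noise =
      ∑ k ∈ Finset.range T, ∫ ω, eqInd 0 (tau r f ω (k + 1)) ∂noise := by
  rw [integral_finsetSum _ fun k _ => integrable_action r f k, Finset.mul_sum]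
  exact Finset.sum_congr rfl fun k _ => (integral_success f hr k).symm

theorem Jr_stationary {r : ℝ} (hr : r ∈ Set.Ioc (0 : ℝ) 1) {g : ℕ → ℝ}
    (hg : ∀ j, g j ∈ Set.Icc (0 : ℝ) 1) {K : ℕ} (hK : ∀ j, K ≤ j → g j = 1) :
    Jr r (stationary g) = ((1 / (r * cycleLength r g K) : ℝ) : EReal) := by
  have hr0 := hr.1
  have hZ := one_le_cycleLength hr hg K
  have h := ((tendsto_meanAvg_stationary hr hg hK 0).add (tendsto_avg_telescope
    (integral_comp_tau_mem r (stationary g) (eqInd_mem 0)))).div_const r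
  have h2 : Tendsto (fun T : ℕ => 1 / (T : ℝ) *
      ∫ ω, ∑ k ∈ Finset.range T, action r (stationary g) ω k ∂noise) atTop
      (𝓝 (1 / (r * cycleLength r g K))) := by
    have he : (occupation r g K 0 + 0) / r = 1 / (r * cycleLength r g K) := by
      rw [occupation, reach_zero, add_zero, div_div, mul_comm]
    rw [← he]
    refine h.congr fun T => ?_
    rw [meanAvg, ← mul_add, ← Finset.sum_add_distrib]
    simp only [add_sub_cancel]
    rw [← sum_integral_eqInd_zero _ ⟨hr.1.le, hr.2⟩]
    field_simp
  exact ((continuous_coe_real_ereal.tendsto _).comp h2).limsup_eq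

/-! ## Optimality of the closed-form rule -/

/-- Stationary probability of holding times at least `j`. -/
def tailOccupation (r : ℝ) (g : ℕ → ℝ) (K j : ℕ) : ℝ :=
  1 - ∑ i ∈ Finset.range j, occupation r g K i

theorem tailOccupation_succ (r : ℝ) (g : ℕ → ℝ) (K j : ℕ) :
    tailOccupation r g K (j + 1) = tailOccupation r g K j - occupation r g K j := by
  rw [tailOccupation, tailOccupation, Finset.sum_range_succ]
  ring

theorem tailOccupation_eq {r : ℝ} (hr : r ∈ Set.Ioc (0 : ℝ) 1) {g : ℕ → ℝ}
    (hg : ∀ j, g j ∈ Set.Icc (0 : ℝ) 1) {K : ℕ} (hK : ∀ j, K ≤ j → g j = 1) {j : ℕ} (hj : K ≤ j) :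
    tailOccupation r g K j = occupation r g K j / r := by
  have hZ := one_le_cycleLength hr hg K
  have hr0 := hr.1
  induction j, hj using Nat.le_induction with
  | base =>
    have h : ∑ i ∈ Finset.range K, reach r g i = cycleLength r g K - reach r g K / r := by
      rw [cycleLength]; ring
    simp only [tailOccupation, occupation]
    rw [← Finset.sum_div, h]
    field_simp
    ring
  | succ j hj ih =>
    rw [tailOccupation_succ, ih, occupation, occupation, reach_succ, hK j hj]
    field_simp

theorem tailOccupation_nonneg {r : ℝ} (hr : r ∈ Set.Ioc (0 : ℝ) 1) {g : ℕ → ℝ}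
    (hg : ∀ j, g j ∈ Set.Icc (0 : ℝ) 1) {K : ℕ} (hK : ∀ j, K ≤ j → g j = 1) (j : ℕ) :
    0 ≤ tailOccupation r g K j := by
  have h1 : 0 ≤ tailOccupation r g K (max j K) := by
    rw [tailOccupation_eq hr hg hK (le_max_right _ _)]
    exact div_nonneg (occupation_nonneg hr hg K _) hr.1.le
  have h2 : tailOccupation r g K (max j K) ≤ tailOccupation r g K j :=
    sub_le_sub_left (Finset.sum_le_sum_of_subset_of_nonneg
      (Finset.range_mono (le_max_left _ _)) fun i _ _ => occupation_nonneg hr hg K i) _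
  exact h1.trans h2

/-- States up to the threshold all have frequency `r * b`, the largest that the budget permits. -/
theorem tailOccupation_ramp {b r : ℝ} (hb : b ∈ Set.Ioc (0 : ℝ) 1) (hr : 0 < r) {j : ℕ}
    (hj : j ≤ threshold b r + 1) :
    tailOccupation r (ramp (rampPoint b r)) (threshold b r + 1) j = 1 - j * (r * b) := by
  have h : ∀ i ∈ Finset.range j,
      occupation r (ramp (rampPoint b r)) (threshold b r + 1) i = r * b := fun i hi => by
    have : (i : ℝ) ≤ threshold b r := by
      have := Finset.mem_range.1 hi
      exact_mod_cast (by omega : i ≤ threshold b r)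
    rw [occupation, cycleLength_ramp hb hr, reach_ramp_of_le (this.trans (threshold_le hb hr))]
    simp
  rw [tailOccupation, Finset.sum_congr rfl h]
  simp

/-- Expected fraction of the times before `T` at which a transmission is made. -/
def meanRate (r : ℝ) (f : Policy) (T : ℕ) : ℝ :=
  1 / (T : ℝ) * ∫ ω, ∑ k ∈ Finset.range T, action r f ω k ∂noise

/-- Each visit to `j + 1` is preceded, one step earlier, by a visit to `j`. -/
theorem meanAvg_eqInd_succ_le (r : ℝ) (f : Policy) (j T : ℕ) :
    meanAvg r f (eqInd (j + 1)) T ≤ meanAvg r f (eqInd j) T := by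
  refine mul_le_mul_of_nonneg_left ?_ (by positivity)
  rcases T with _ | T
  · simp
  rw [Finset.sum_range_succ', Finset.sum_range_succ]
  have h0 : ∫ ω, eqInd (j + 1) (tau r f ω 0) ∂noise = 0 := by simp [tau_zero]
  rw [h0]
  refine add_le_add (Finset.sum_le_sum fun k _ => ?_)
    (integral_comp_tau_mem r f (eqInd_mem j) T).1
  refine integral_mono (integrable_comp_tau _ _ _ _) (integrable_comp_tau _ _ _ _) fun ω => ?_
  have h1 := success_mem r f ω k
  have h2 := eqInd_mem j (tau r f ω k)
  simp only [apply_tau_succ (eqInd (j + 1)), eqInd_succ_succ, eqInd_succ_zero]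
  nlinarith [h1.1, h2.1]

/-- The term `1 / T` accounts for the start in state `0`; every other visit is a success. -/
theorem meanAvg_eqInd_zero_le (f : Policy) {r : ℝ} (hr : r ∈ Set.Icc (0 : ℝ) 1) (T : ℕ) :
    meanAvg r f (eqInd 0) T ≤ 1 / (T : ℝ) + r * meanRate r f T := by
  have h : r * meanRate r f T = 1 / (T : ℝ) *
      ∑ k ∈ Finset.range T, ∫ ω, eqInd 0 (tau r f ω (k + 1)) ∂noise := by
    rw [← sum_integral_eqInd_zero f hr, meanRate]
    ring
  rw [h, meanAvg, ← mul_one_add]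
  refine mul_le_mul_of_nonneg_left ?_ (by positivity)
  have h1 := Finset.sum_range_succ' (fun k => ∫ ω, eqInd 0 (tau r f ω k) ∂noise) T
  rw [Finset.sum_range_succ] at h1
  have h2 := (integral_comp_tau_mem r f (eqInd_mem 0) 0).2
  have h3 := (integral_comp_tau_mem r f (eqInd_mem 0) T).1
  linarith

theorem le_meanAvg_geInd (f : Policy) {r : ℝ}
    (hr : r ∈ Set.Icc (0 : ℝ) 1) (j : ℕ) {T : ℕ} (hT : T ≠ 0) :
    1 - j * (1 / (T : ℝ) + r * meanRate r f T) ≤ meanAvg r f (geInd j) T := by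
  have h1 := sum_eqInd_add_geInd_meanAvg r f j hT
  have h2 : ∀ i, meanAvg r f (eqInd i) T ≤ 1 / (T : ℝ) + r * meanRate r f T := fun i => by
    induction i with
    | zero => exact meanAvg_eqInd_zero_le f hr T
    | succ i ih => exact (meanAvg_eqInd_succ_le r f i T).trans ih
  have h3 := Finset.sum_le_sum fun i (_ : i ∈ Finset.range j) => h2 i
  simp only [Finset.sum_const, Finset.card_range, nsmul_eq_mul] at h3
  linarith

/-- In any state, success has probability at most `r`, so the holding time keeps growing with
probability at least `1 - r`. -/
theorem Admissible.le_meanAvg_geInd_succ {f : Policy} (hf : Admissible f) {r : ℝ}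
    (hr : r ∈ Set.Icc (0 : ℝ) 1) (j T : ℕ) :
    (1 - r) * meanAvg r f (geInd j) T - 1 / (T : ℝ) ≤ meanAvg r f (geInd (j + 1)) T := by
  have h : ∀ k, (1 - r) * ∫ ω, geInd j (tau r f ω k) ∂noise ≤
      ∫ ω, geInd (j + 1) (tau r f ω (k + 1)) ∂noise := fun k => by
    rw [hf.integral_tau_succ hr, ← integral_const_mul]
    have hi := (integrable_comp_tau r f k fun n => geInd (j + 1) (n + 1)).add
      (hf.integrable_mul_txProb r k fun n => geInd (j + 1) 0 - geInd (j + 1) (n + 1))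
    refine integral_mono ((integrable_comp_tau r f k (geInd j)).const_mul _) hi fun ω => ?_
    have h1 := hf.txProb_mem r ω k
    have h2 := geInd_mem j (tau r f ω k)
    have h3 : 0 ≤ geInd j (tau r f ω k) * (r * (1 - txProb r f ω k)) :=
      mul_nonneg h2.1 (mul_nonneg hr.1 (by linarith [h1.2]))
    simp only [geInd_succ_succ, geInd_succ_zero]
    linarith
  have h1 := Finset.sum_range_succ' (fun k => ∫ ω, geInd (j + 1) (tau r f ω k) ∂noise) T
  rw [Finset.sum_range_succ] at h1
  have h2 := (integral_comp_tau_mem r f (geInd_mem (j + 1)) 0).1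
  have h3 := (integral_comp_tau_mem r f (geInd_mem (j + 1)) T).2
  have h4 := Finset.sum_le_sum fun k (_ : k ∈ Finset.range T) => h k
  rw [← Finset.mul_sum] at h4
  have h5 : (1 - r) * ∑ k ∈ Finset.range T, ∫ ω, geInd j (tau r f ω k) ∂noise - 1 ≤
      ∑ k ∈ Finset.range T, ∫ ω, geInd (j + 1) (tau r f ω k) ∂noise := by linarith
  have h6 := mul_le_mul_of_nonneg_left h5 (by positivity : (0 : ℝ) ≤ 1 / T)
  simp only [meanAvg]
  linarith

/-- The threshold rule minimises all tails at once: the budget bound is tight up to `threshold b r +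
1`, and the channel bound `1 - r` per step is tight afterwards. -/
theorem eventually_lt_meanAvg_geInd {b r : ℝ} (hb : b ∈ Set.Ioc (0 : ℝ) 1)
    (hr : r ∈ Set.Ioc (0 : ℝ) 1) {f : Policy} (hf : Feasible r b f) (j : ℕ) {ε : ℝ} (hε : 0 < ε) :
    ∀ᶠ T in atTop, tailOccupation r (ramp (rampPoint b r)) (threshold b r + 1) j - ε <
      meanAvg r f (geInd j) T := by
  have hr' : r ∈ Set.Icc (0 : ℝ) 1 := ⟨hr.1.le, hr.2⟩
  have hinv := tendsto_one_div_atTop_nhds_zero_nat (𝕜 := ℝ)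
  induction j generalizing ε with
  | zero =>
    filter_upwards [eventually_ne_atTop 0] with T hT
    have := le_meanAvg_geInd f hr' 0 hT
    simp only [Nat.cast_zero, zero_mul] at this
    simp only [tailOccupation, Finset.range_zero, Finset.sum_empty]
    linarith
  | succ j ih =>
    by_cases hj : j + 1 ≤ threshold b r + 1
    · rw [tailOccupation_ramp hb hr.1 hj]
      have hj0 : (0 : ℝ) < (j + 1 : ℕ) := by positivity
      -- Two errors below `δ`, from `1 / T` and from the rate exceeding `b`, are multiplied by `j +
      -- 1`.
      set δ := ε / (2 * (j + 1 : ℕ)) with hδ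
      have hδ0 : 0 < δ := by positivity
      have hδ1 : ((j + 1 : ℕ) : ℝ) * δ * 2 = ε := by rw [hδ]; field_simp
      have hlim : Jr r f < ((b + δ : ℝ) : EReal) :=
        hf.2.trans_lt (EReal.coe_lt_coe_iff.2 (by linarith))
      filter_upwards [eventually_lt_of_limsup_lt hlim, eventually_ne_atTop 0,
        hinv.eventually_lt_const hδ0] with T h1 hT h2
      have h3 : meanRate r f T < b + δ := EReal.coe_lt_coe_iff.1 h1
      refine lt_of_lt_of_le ?_ (le_meanAvg_geInd f hr' (j + 1) hT)
      have h4 : r * meanRate r f T ≤ r * b + δ := by nlinarith [hr.1, hr.2]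
      have h5 : 1 / (T : ℝ) + r * meanRate r f T < r * b + 2 * δ := by linarith
      nlinarith
    · have hj' : threshold b r + 1 ≤ j := by omega
      have hK : ∀ i, threshold b r + 1 ≤ i → ramp (rampPoint b r) i = 1 := fun i hi =>
        ramp_of_le (rampPoint_lt.le.trans (by exact_mod_cast hi))
      have htail : tailOccupation r (ramp (rampPoint b r)) (threshold b r + 1) (j + 1) =
          (1 - r) * tailOccupation r (ramp (rampPoint b r)) (threshold b r + 1) j := by
        have h := tailOccupation_eq hr (ramp_mem _) hK hj'
        have hr0 := hr.1.ne'
        rw [tailOccupation_succ, (div_eq_iff hr0).1 h.symm]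
        ring
      filter_upwards [ih (half_pos hε), hinv.eventually_lt_const (half_pos hε)] with T h1 h2
      have h3 := hf.1.le_meanAvg_geInd_succ hr' j T
      have h4 : (1 - r) * (tailOccupation r (ramp (rampPoint b r)) (threshold b r + 1) j - ε / 2) ≤
          (1 - r) * meanAvg r f (geInd j) T :=
        mul_le_mul_of_nonneg_left h1.le (by linarith [hr.2])
      rw [htail]
      nlinarith [hr.1]

theorem sum_mul_diff_add_eq (c t : ℕ → ℝ) (N : ℕ) :
    ∑ j ∈ Finset.range (N + 1), c j * (t j - t (j + 1)) + c N * t (N + 1) =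
      c 0 * t 0 + ∑ j ∈ Finset.range N, (c (j + 1) - c j) * t (j + 1) := by
  induction N with
  | zero => simp; ring
  | succ N ih =>
    rw [Finset.sum_range_succ, Finset.sum_range_succ (n := N) (f := fun j =>
      (c (j + 1) - c j) * t (j + 1)), ← add_assoc, ← ih]
    ring

theorem add_sum_geInd_eq (c : ℕ → ℝ) (N n : ℕ) :
    c 0 + ∑ j ∈ Finset.range N, (c (j + 1) - c j) * geInd (j + 1) n = c (min N n) := by
  induction N with
  | zero => simp
  | succ N ih =>
    rw [Finset.sum_range_succ, ← add_assoc, ih, geInd]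
    split_ifs with h
    · rw [min_eq_left (by omega : N ≤ n), min_eq_left h]
      ring
    · rw [min_eq_right (by omega : n ≤ N), min_eq_right (by omega : n ≤ N + 1)]
      ring

/-- Summation by parts writes a cost as `c 0` plus nonnegative increments times tails, so the tail
bounds suffice. Truncating at `N` involves only finitely many tails; `N` then tends to infinity. -/
theorem avgCost_le_Je {c : ℕ → ℝ} (hc : ∀ j, 0 ≤ c j) (hmono : Monotone c) {b r : ℝ}
    (hb : b ∈ Set.Ioc (0 : ℝ) 1) (hr : r ∈ Set.Ioc (0 : ℝ) 1) {f : Policy} (hf : Feasible r b f) :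
    (avgCost c r (ramp (rampPoint b r)) (threshold b r + 1) : EReal) ≤ Je c r f := by
  set K := threshold b r + 1 with hKdef
  set g := ramp (rampPoint b r) with hgdef
  have hg : ∀ j, g j ∈ Set.Icc (0 : ℝ) 1 := ramp_mem _
  have hK : ∀ j, K ≤ j → g j = 1 := fun j hj =>
    ramp_of_le (rampPoint_lt.le.trans (by exact_mod_cast hj))
  have hocc : ∀ j, occupation r g K j = tailOccupation r g K j - tailOccupation r g K (j + 1) :=
    fun j => by rw [tailOccupation_succ]; ring
  have key : ∀ N, ((∑ j ∈ Finset.range (N + 1), c j * occupation r g K j : ℝ) : EReal) ≤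
      Je c r f := fun N => by
    have h1 : ∑ j ∈ Finset.range (N + 1), c j * occupation r g K j ≤
        c 0 + ∑ j ∈ Finset.range N, (c (j + 1) - c j) * tailOccupation r g K (j + 1) := by
      have h := sum_mul_diff_add_eq c (tailOccupation r g K) N
      have h0 : tailOccupation r g K 0 = 1 := by simp [tailOccupation]
      have h2 := mul_nonneg (hc N) (tailOccupation_nonneg hr hg hK (N + 1))
      simp_rw [hocc]
      rw [h0, mul_one] at h
      linarith
    refine EReal.ge_of_forall_gt_iff_ge.1 fun y hy => ?_
    rw [EReal.coe_lt_coe_iff] at hy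
    -- The increments up to `N` sum to `c N - c 0`, so an error `δ` in each tail costs at most `ε`;
    -- the added `1` keeps the denominator positive.
    set ε := (∑ j ∈ Finset.range (N + 1), c j * occupation r g K j - y) with hε
    have hε0 : 0 < ε := sub_pos.2 hy
    set δ := ε / (c N - c 0 + 1) with hδ
    have hden : 0 < c N - c 0 + 1 := by linarith [hmono (Nat.zero_le N)]
    have hδ0 : 0 < δ := div_pos hε0 hden
    refine le_limsup_of_frequently_le (Eventually.frequently ?_)
    filter_upwards [(Finset.eventually_all (Finset.range N)).2 fun j _ =>
      eventually_lt_meanAvg_geInd hb hr hf (j + 1) hδ0, eventually_ne_atTop 0] with T hT hT0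
    rw [integral_sum_comp_tau, EReal.coe_le_coe_iff]
    have h2 : c 0 + ∑ j ∈ Finset.range N, (c (j + 1) - c j) * meanAvg r f (geInd (j + 1)) T ≤
        meanAvg r f c T := by
      have h := meanAvg_mono r f (F := fun n =>
        c 0 * 1 + ∑ j ∈ Finset.range N, (c (j + 1) - c j) * geInd (j + 1) n) (G := c)
        (fun n => by rw [mul_one, add_sum_geInd_eq]; exact hmono (min_le_right _ _)) T
      rw [meanAvg_add, meanAvg_const_mul, meanAvg_one r f hT0, mul_one, meanAvg_sum] at h
      simpa only [meanAvg_const_mul] using h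
    have h3 : ∑ j ∈ Finset.range N, (c (j + 1) - c j) * (tailOccupation r g K (j + 1) - δ) ≤
        ∑ j ∈ Finset.range N, (c (j + 1) - c j) * meanAvg r f (geInd (j + 1)) T :=
      Finset.sum_le_sum fun j hj => mul_le_mul_of_nonneg_left (hT j hj).le
        (sub_nonneg.2 (hmono j.le_succ))
    simp_rw [mul_sub] at h3
    rw [Finset.sum_sub_distrib, ← Finset.sum_mul, Finset.sum_range_sub] at h3
    have h4 : (c N - c 0) * δ ≤ ε := by
      have : (c N - c 0 + 1) * δ = ε := by rw [hδ]; field_simp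
      linarith
    linarith
  have hconv : Tendsto (fun N => ((∑ j ∈ Finset.range (N + 1),
      ENNReal.ofReal (c j) * ENNReal.ofReal (occupation r g K j) : ℝ≥0∞) : EReal)) atTop
      (𝓝 (avgCost c r g K : EReal)) :=
    (continuous_coe_ennreal_ereal.tendsto _).comp
      ((tendsto_add_atTop_iff_nat 1).2 ENNReal.summable.hasSum.tendsto_sum_nat)
  refine le_of_tendsto' hconv fun N => le_trans (le_of_eq ?_) (key N)
  have hnn : ∀ j, 0 ≤ c j * occupation r g K j := fun j =>
    mul_nonneg (hc j) (occupation_nonneg hr hg K j)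
  rw [← max_eq_left (Finset.sum_nonneg fun j (_ : j ∈ Finset.range (N + 1)) => hnn j),
    ← EReal.coe_ennreal_ofReal, ENNReal.ofReal_sum_of_nonneg fun j _ => hnn j]
  simp_rw [ENNReal.ofReal_mul (hc _)]

theorem ramp_eq_one_of_threshold_lt {b r : ℝ} {j : ℕ} (hj : threshold b r + 1 ≤ j) :
    ramp (rampPoint b r) j = 1 :=
  ramp_of_le (rampPoint_lt.le.trans (by exact_mod_cast hj))

theorem Je_ramp {c : ℕ → ℝ} (hc : ∀ j, 0 ≤ c j) {b r : ℝ} (hr : r ∈ Set.Ioc (0 : ℝ) 1) :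
    Je c r (stationary (ramp (rampPoint b r))) =
      (avgCost c r (ramp (rampPoint b r)) (threshold b r + 1) : EReal) :=
  Je_stationary hc hr (ramp_mem _) fun _ => ramp_eq_one_of_threshold_lt

theorem isOptimal_closedFormRule {c : ℕ → ℝ} (hc : ∀ j, 0 ≤ c j) (hmono : Monotone c) {b r : ℝ}
    (hb : b ∈ Set.Ioc (0 : ℝ) 1) (hr : r ∈ Set.Ioc (0 : ℝ) 1) :
    IsOptimal c r b (stationary (closedFormRule b r)) := by
  rw [closedFormRule_eq_ramp hb hr.1]
  refine ⟨⟨admissible_stationary (ramp_mem _), ?_⟩, fun f hf => ?_⟩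
  · rw [Jr_stationary hr (ramp_mem _) fun _ => ramp_eq_one_of_threshold_lt,
      cycleLength_ramp hb hr.1, EReal.coe_le_coe_iff]
    have h1 := hr.1
    have h2 := hb.1
    apply le_of_eq
    field_simp
  · rw [Je_ramp hc hr]
    exact avgCost_le_Je hc hmono hb hr hf

theorem optValue_eq_avgCost {c : ℕ → ℝ} (hc : ∀ j, 0 ≤ c j) (hmono : Monotone c) {b r : ℝ}
    (hb : b ∈ Set.Ioc (0 : ℝ) 1) (hr : r ∈ Set.Ioc (0 : ℝ) 1) :
    optValue c r b = (avgCost c r (ramp (rampPoint b r)) (threshold b r + 1) : EReal) := by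
  have h := isOptimal_closedFormRule hc hmono hb hr
  rw [closedFormRule_eq_ramp hb hr.1] at h
  refine le_antisymm (sInf_le ⟨_, h.1, (Je_ramp hc hr).symm⟩) (le_sInf ?_)
  rintro x ⟨f, hf, rfl⟩
  exact avgCost_le_Je hc hmono hb hr hf

/-! ## The maximal ergodic inequality -/

section Maximal

variable {Ω : Type*}

/-- Maximum of `0` and the first `N` partial sums of `f` along the orbit of `T`. -/
def maxPartialSum (T : Ω → Ω) (f : Ω → ℝ) : ℕ → Ω → ℝ
  | 0 => fun _ => 0
  | N + 1 => fun x => max 0 (f x + maxPartialSum T f N (T x))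

theorem maxPartialSum_nonneg (T : Ω → Ω) (f : Ω → ℝ) (N : ℕ) (x : Ω) :
    0 ≤ maxPartialSum T f N x := by
  cases N with
  | zero => exact le_rfl
  | succ N => exact le_max_left _ _

theorem maxPartialSum_le_succ (T : Ω → Ω) (f : Ω → ℝ) (N : ℕ) (x : Ω) :
    maxPartialSum T f N x ≤ maxPartialSum T f (N + 1) x := by
  induction N generalizing x with
  | zero => exact le_max_left _ _
  | succ N ih => exact max_le_max le_rfl (by gcongr; exact ih _)

theorem sum_iterate_le_maxPartialSum (T : Ω → Ω) (f : Ω → ℝ) (N : ℕ) (x : Ω) :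
    ∑ k ∈ Finset.range N, f (T^[k] x) ≤ maxPartialSum T f N x := by
  induction N generalizing x with
  | zero => exact le_rfl
  | succ N ih =>
    rw [Finset.sum_range_succ', add_comm]
    exact (add_le_add le_rfl (ih (T x))).trans (le_max_right _ _)

variable [MeasurableSpace Ω] {μ : Measure Ω}

theorem measurable_maxPartialSum {T : Ω → Ω} (hT : Measurable T) {f : Ω → ℝ} (hf : Measurable f)
    (N : ℕ) : Measurable (maxPartialSum T f N) := by
  induction N with
  | zero => exact measurable_const
  | succ N ih => exact measurable_const.max (hf.add (ih.comp hT))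

theorem integrable_maxPartialSum {T : Ω → Ω} (hT : MeasurePreserving T μ μ) {f : Ω → ℝ}
    (hf : Integrable f μ) (N : ℕ) : Integrable (maxPartialSum T f N) μ := by
  induction N with
  | zero => exact integrable_zero _ _ _
  | succ N ih => exact (integrable_zero _ _ _).sup (hf.add (hT.integrable_comp_of_integrable ih))

/-- Hopf's maximal ergodic theorem. -/
theorem setIntegral_maxPartialSum_pos_nonneg {T : Ω → Ω} (hT : MeasurePreserving T μ μ) {f : Ω → ℝ}
    (hfm : Measurable f) (hf : Integrable f μ) (N : ℕ) :
    0 ≤ ∫ x in {x | 0 < maxPartialSum T f (N + 1) x}, f x ∂μ := by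
  have hM := integrable_maxPartialSum hT hf (N + 1)
  have hMT : Integrable (fun x => maxPartialSum T f (N + 1) (T x)) μ :=
    hT.integrable_comp_of_integrable hM
  have hmeas : MeasurableSet {x | 0 < maxPartialSum T f (N + 1) x} :=
    measurableSet_lt measurable_const (measurable_maxPartialSum hT.measurable hfm _)
  have h0 : ∫ x, (maxPartialSum T f (N + 1) x - maxPartialSum T f (N + 1) (T x)) ∂μ = 0 := by
    rw [integral_sub hM hMT, sub_eq_zero]
    conv_lhs => rw [← hT.map_eq]
    exact integral_map hT.measurable.aemeasurable
      (measurable_maxPartialSum hT.measurable hfm _).aestronglyMeasurable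
  rw [← integral_indicator hmeas]
  refine h0.symm.le.trans ?_
  refine integral_mono (hM.sub hMT) (hf.indicator hmeas) fun x => ?_
  -- With `M` the maximum, `M x - M (T x) ≤ f x` where `M x` is positive, since the maximum over one
  -- sum fewer at `T x` is at most `M (T x)`. Elsewhere `M x = 0 ≤ M (T x)`.
  by_cases hx : 0 < maxPartialSum T f (N + 1) x
  · rw [Set.indicator_of_mem (by exact hx)]
    have h1 : maxPartialSum T f (N + 1) x = f x + maxPartialSum T f N (T x) := by
      rw [maxPartialSum] at hx ⊢
      rcases lt_max_iff.1 hx with h | h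
      · exact absurd h (lt_irrefl _)
      · exact max_eq_right h.le
    have h2 := maxPartialSum_le_succ T f N (T x)
    simp only []
    linarith
  · rw [Set.indicator_of_notMem (by exact hx)]
    have h1 := maxPartialSum_nonneg T f (N + 1) (T x)
    simp only []
    linarith

/-- Hopf's inequality for `f - l`: one bound covers all horizons `n` simultaneously. -/
theorem measure_exists_lt_sum_iterate_le [IsProbabilityMeasure μ] {T : Ω → Ω}
    (hT : MeasurePreserving T μ μ) {f : Ω → ℝ} (hfm : Measurable f) (hf : Integrable f μ)
    (hf0 : ∀ x, 0 ≤ f x) {l : ℝ} (hl : 0 < l) :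
    μ {x | ∃ n : ℕ, l * n < ∑ k ∈ Finset.range n, f (T^[k] x)} ≤
      ENNReal.ofReal ((∫ x, f x ∂μ) / l) := by
  set g : Ω → ℝ := fun x => f x - l with hg
  have hgm : Measurable g := hfm.sub_const l
  have hgi : Integrable g μ := hf.sub (integrable_const l)
  have hsub : {x | ∃ n : ℕ, l * n < ∑ k ∈ Finset.range n, f (T^[k] x)} ⊆
      ⋃ N, {x | 0 < maxPartialSum T g (N + 1) x} := by
    rintro x ⟨n, hn⟩
    refine Set.mem_iUnion.2 ⟨n, lt_of_lt_of_le ?_ (maxPartialSum_le_succ T g n x)⟩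
    refine lt_of_lt_of_le ?_ (sum_iterate_le_maxPartialSum T g n x)
    simp only [hg, Finset.sum_sub_distrib, Finset.sum_const, Finset.card_range, nsmul_eq_mul]
    linarith
  refine (measure_mono hsub).trans ?_
  have hmono : Monotone fun N => {x | 0 < maxPartialSum T g (N + 1) x} :=
    monotone_nat_of_le_succ fun N x (hx : 0 < maxPartialSum T g (N + 1) x) =>
      hx.trans_le (maxPartialSum_le_succ T g (N + 1) x)
  rw [hmono.measure_iUnion]
  refine iSup_le fun N => ?_
  set A := {x | 0 < maxPartialSum T g (N + 1) x} with hA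
  have h1 := setIntegral_maxPartialSum_pos_nonneg hT hgm hgi N
  simp only [hg] at h1
  rw [integral_sub hf.integrableOn (integrable_const l).integrableOn] at h1
  have h2 : ∫ x in A, f x ∂μ ≤ ∫ x, f x ∂μ := setIntegral_le_integral hf (ae_of_all _ hf0)
  simp only [integral_const, smul_eq_mul, measureReal_restrict_apply_univ] at h1
  have h3 : μ.real A ≤ (∫ x, f x ∂μ) / l := by
    rw [le_div_iff₀ hl]
    exact (sub_nonneg.1 h1).trans h2
  rw [← ofReal_measureReal]
  exact ENNReal.ofReal_le_ofReal h3

theorem measure_exists_lt_sum_iterate_le_lintegral [IsProbabilityMeasure μ] {T : Ω → Ω}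
    (hT : MeasurePreserving T μ μ) {F : Ω → ℝ≥0∞} (hF : Measurable F) (hF' : ∫⁻ x, F x ∂μ ≠ ∞)
    {l : ℝ} (hl : 0 < l) :
    μ {x | ∃ n : ℕ, ENNReal.ofReal l * n < ∑ k ∈ Finset.range n, F (T^[k] x)} ≤
      (∫⁻ x, F x ∂μ) / ENNReal.ofReal l := by
  have hfin : ∀ᵐ x ∂μ, ∀ k, F (T^[k] x) < ∞ :=
    ae_all_iff.2 fun k => (hT.iterate k).quasiMeasurePreserving.ae (ae_lt_top hF hF')
  have hint : Integrable (fun x => (F x).toReal) μ := integrable_toReal_of_lintegral_ne_top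
    hF.aemeasurable hF'
  have h := measure_exists_lt_sum_iterate_le hT hF.ennreal_toReal hint
    (fun x => ENNReal.toReal_nonneg) hl
  rw [integral_toReal hF.aemeasurable (ae_lt_top hF hF'), ENNReal.ofReal_div_of_pos hl,
    ENNReal.ofReal_toReal hF'] at h
  refine le_trans (measure_mono_ae ?_) h
  filter_upwards [hfin] with x hx ⟨n, hn⟩
  refine ⟨n, ?_⟩
  rw [← ENNReal.toReal_sum fun k _ => (hx k).ne]
  have h1 : ∑ k ∈ Finset.range n, F (T^[k] x) ≠ ∞ := ENNReal.sum_ne_top.2 fun k _ => (hx k).ne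
  have h2 := (ENNReal.toReal_lt_toReal (ne_top_of_lt hn) h1).2 hn
  rwa [ENNReal.toReal_mul, ENNReal.toReal_ofReal hl.le, ENNReal.toReal_natCast] at h2

end Maximal

/-! ## Runs of channel failures -/

/-- Time shift of the noise. -/
def shift (ω : Noise) : Noise := fun k => ω (k + 1)

theorem measurePreserving_shift : MeasurePreserving shift noise noise where
  measurable := measurable_pi_lambda _ fun k => measurable_pi_apply (k + 1)
  map_eq := Measure.map_infinitePi_infinitePi_of_inj (f := fun k : ℕ => k + 1)
    (add_left_injective 1)

theorem shift_iterate (ω : Noise) (s l : ℕ) : (shift^[s] ω) l = ω (l + s) := by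
  induction s generalizing l with
  | zero => rfl
  | succ s ih =>
    rw [Function.iterate_succ_apply', shift, ih]
    congr 1
    omega

/-- The event that the channel fails at each of the times `0, …, i - 1`. -/
def failRun (r : ℝ) (i : ℕ) : Set Noise := {ω | ∀ l < i, r ≤ ((ω l).2 : ℝ)}

theorem failRun_eq_pi (r : ℝ) (i : ℕ) : failRun r i =
    Set.pi (Finset.range i) fun _ => {z : unitInterval × unitInterval | r ≤ (z.2 : ℝ)} := by
  ext ω
  simp [failRun, Set.mem_pi]

theorem measurableSet_channel_fail (r : ℝ) :
    MeasurableSet {z : unitInterval × unitInterval | r ≤ (z.2 : ℝ)} :=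
  measurableSet_le measurable_const (measurable_subtype_coe.comp measurable_snd)

theorem measurableSet_failRun (r : ℝ) (i : ℕ) : MeasurableSet (failRun r i) := by
  rw [failRun_eq_pi]
  exact MeasurableSet.pi (Finset.countable_toSet _) fun _ _ => measurableSet_channel_fail r

theorem noise_failRun {r : ℝ} (hr : r ∈ Set.Icc (0 : ℝ) 1) (i : ℕ) :
    noise (failRun r i) = ENNReal.ofReal ((1 - r) ^ i) := by
  have h : (volume : Measure (unitInterval × unitInterval)) {z | r ≤ (z.2 : ℝ)} =
      ENNReal.ofReal (1 - r) := by
    have : {z : unitInterval × unitInterval | r ≤ (z.2 : ℝ)} =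
        Set.univ ×ˢ Set.Ici (⟨r, hr⟩ : unitInterval) := by
      ext z
      simp [← Subtype.coe_le_coe]
    rw [this, Measure.volume_eq_prod, Measure.prod_prod]
    simp
  rw [failRun_eq_pi, noise, Measure.infinitePi_pi _ fun _ _ => measurableSet_channel_fail r]
  simp only [h, Finset.prod_const, Finset.card_range]
  rw [ENNReal.ofReal_pow (by linarith [hr.2])]

/-- Number of consecutive channel failures just before time `t`. -/
def runLength (r : ℝ) (ω : Noise) : ℕ → ℕ
  | 0 => 0
  | t + 1 => if ((ω t).2 : ℝ) < r then 0 else runLength r ω t + 1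

theorem runLength_le (r : ℝ) (ω : Noise) (t : ℕ) : runLength r ω t ≤ t := by
  induction t with
  | zero => exact le_rfl
  | succ t ih =>
    rw [runLength]
    split_ifs <;> omega

theorem le_noise_of_runLength (r : ℝ) (ω : Noise) (t l : ℕ) (h1 : t - runLength r ω t ≤ l)
    (h2 : l < t) : r ≤ ((ω l).2 : ℝ) := by
  induction t with
  | zero => omega
  | succ t ih =>
    rw [runLength] at h1
    split_ifs at h1 with h
    · omega
    · rcases Nat.lt_succ_iff_lt_or_eq.1 h2 with h3 | rfl
      · exact ih (by omega) h3
      · exact not_lt.1 h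

theorem mem_failRun_of_runLength (r : ℝ) (ω : Noise) (t : ℕ) :
    shift^[t - runLength r ω t] ω ∈ failRun r (runLength r ω t) := by
  intro l hl
  rw [shift_iterate]
  have := runLength_le r ω t
  exact le_noise_of_runLength r ω t _ (by omega) (by omega)

/-- Sum of `d i` over the initial failure runs of length `i`. -/
def runCost (r : ℝ) (d : ℕ → ℝ≥0∞) (ω : Noise) : ℝ≥0∞ :=
  ∑' i, (failRun r i).indicator (fun _ => d i) ω

theorem measurable_runCost (r : ℝ) (d : ℕ → ℝ≥0∞) : Measurable (runCost r d) :=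
  Measurable.tsum fun i => measurable_const.indicator (measurableSet_failRun r i)

theorem lintegral_runCost {r : ℝ} (hr : r ∈ Set.Icc (0 : ℝ) 1) (d : ℕ → ℝ≥0∞) :
    ∫⁻ ω, runCost r d ω ∂noise = ∑' i, d i * ENNReal.ofReal ((1 - r) ^ i) := by
  unfold runCost
  rw [lintegral_tsum fun i =>
    (measurable_const.indicator (measurableSet_failRun r i)).aemeasurable]
  refine tsum_congr fun i => ?_
  rw [lintegral_indicator_const (measurableSet_failRun r i), noise_failRun hr]

/-- The run ending just before `t` is charged to its starting time. Start and length determine `t`,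
so no charge is used twice, and the charges at a start `s` are among the terms of `runCost` for the
noise shifted by `s`. The right side is a sum along an orbit of the shift. -/
theorem sum_runLength_le (r : ℝ) (d : ℕ → ℝ≥0∞) (ω : Noise) (T : ℕ) :
    ∑ t ∈ Finset.range T, d (runLength r ω t) ≤
      ∑ s ∈ Finset.range T, runCost r d (shift^[s] ω) := by
  classical
  set G : ℕ × ℕ → ℝ≥0∞ := fun p => (failRun r p.2).indicator (fun _ => d p.2) (shift^[p.1] ω)
    with hG
  set e : ℕ → ℕ × ℕ := fun t => (t - runLength r ω t, runLength r ω t) with he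
  have hinj : Set.InjOn e (Finset.range T) := fun t _ t' _ h => by
    simp only [he, Prod.mk.injEq] at h
    have := runLength_le r ω t
    have := runLength_le r ω t'
    omega
  calc ∑ t ∈ Finset.range T, d (runLength r ω t) = ∑ t ∈ Finset.range T, G (e t) :=
        Finset.sum_congr rfl fun t _ =>
          (Set.indicator_of_mem (mem_failRun_of_runLength r ω t)
            (fun _ => d (runLength r ω t))).symm
    _ = ∑ p ∈ (Finset.range T).image e, G p := (Finset.sum_image hinj).symm
    _ ≤ ∑ p ∈ Finset.range T ×ˢ Finset.range T, G p := by
        refine Finset.sum_le_sum_of_subset fun p hp => ?_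
        obtain ⟨t, ht, rfl⟩ := Finset.mem_image.1 hp
        have := runLength_le r ω t
        have := Finset.mem_range.1 ht
        simp only [he, Finset.mem_product, Finset.mem_range]
        omega
    _ = ∑ s ∈ Finset.range T, ∑ i ∈ Finset.range T, G (s, i) := Finset.sum_product _ _ _
    _ ≤ _ := Finset.sum_le_sum fun s _ => ENNReal.sum_le_tsum _

/-- By the maximal inequality, the probability that some `T` violates the bound is at most a tail of
the convergent series divided by `ε`, which vanishes as `L` grows. -/
theorem ae_sum_long_runs_le {r : ℝ} (hr : r ∈ Set.Icc (0 : ℝ) 1) {d : ℕ → ℝ≥0∞}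
    (hd : ∑' i, d i * ENNReal.ofReal ((1 - r) ^ i) ≠ ∞) :
    ∀ᵐ ω ∂noise, ∀ ε : ℝ, 0 < ε → ∃ L, ∀ T : ℕ,
      ∑ t ∈ Finset.range T, (if L ≤ runLength r ω t then d (runLength r ω t) else 0) ≤
        ENNReal.ofReal ε * T := by
  have key : ∀ ε : ℝ, 0 < ε → ∀ᵐ ω ∂noise, ∃ L, ∀ T : ℕ,
      ∑ t ∈ Finset.range T, (if L ≤ runLength r ω t then d (runLength r ω t) else 0) ≤
        ENNReal.ofReal ε * T := by
    intro ε hε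
    set D : ℕ → ℕ → ℝ≥0∞ := fun L i => if L ≤ i then d i else 0 with hD
    have hDsum : ∀ L, ∑' i, D L i * ENNReal.ofReal ((1 - r) ^ i) =
        ∑' i, d (i + L) * ENNReal.ofReal ((1 - r) ^ (i + L)) := fun L => by
      rw [← Summable.sum_add_tsum_nat_add' (k := L) ENNReal.summable, Finset.sum_eq_zero, zero_add]
      · simp [hD]
      · intro i hi
        simp [hD, Finset.mem_range.1 hi]
    have hlim := ENNReal.tendsto_sum_nat_add _ hd
    have hle : ∀ L, noise {ω | ∃ T : ℕ, ENNReal.ofReal ε * T <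
        ∑ t ∈ Finset.range T, D L (runLength r ω t)} ≤
          (∑' i, d (i + L) * ENNReal.ofReal ((1 - r) ^ (i + L))) / ENNReal.ofReal ε := fun L => by
      have hne : ∫⁻ ω, runCost r (D L) ω ∂noise ≠ ∞ := by
        rw [lintegral_runCost hr, hDsum]
        exact ne_top_of_le_ne_top hd
          (ENNReal.tsum_comp_le_tsum_of_injective (add_left_injective L) _)
      have h := measure_exists_lt_sum_iterate_le_lintegral measurePreserving_shift
        (measurable_runCost r (D L)) hne hε
      rw [lintegral_runCost hr, hDsum] at h
      refine le_trans (measure_mono ?_) h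
      rintro ω ⟨T, hT⟩
      exact ⟨T, hT.trans_le (sum_runLength_le r (D L) ω T)⟩
    have hzero : noise (⋂ L, {ω | ∃ T : ℕ, ENNReal.ofReal ε * T <
        ∑ t ∈ Finset.range T, D L (runLength r ω t)}) = 0 := by
      have hlim' := ENNReal.Tendsto.div_const hlim
        (Or.inr (ENNReal.ofReal_pos.2 hε).ne' : (0 : ℝ≥0∞) ≠ 0 ∨ ENNReal.ofReal ε ≠ 0)
      rw [ENNReal.zero_div] at hlim'
      exact le_antisymm (ge_of_tendsto' hlim' fun L =>
        (measure_mono (Set.iInter_subset _ L)).trans (hle L)) zero_le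
    refine measure_mono_null (fun ω hω => ?_) hzero
    refine Set.mem_iInter.2 fun L => ?_
    by_contra hcon
    refine hω ⟨L, fun T => ?_⟩
    by_contra hT
    exact hcon ⟨T, not_le.1 hT⟩
  have h := ae_all_iff.2 fun m : ℕ => key (1 / ((m : ℝ) + 1)) (by positivity)
  filter_upwards [h] with ω hω ε hε
  obtain ⟨m, hm⟩ := exists_nat_one_div_lt hε
  obtain ⟨L, hL⟩ := hω m
  exact ⟨L, fun T => (hL T).trans (by gcongr)⟩

/-! ## The estimate of the success probability -/

theorem numSucc_history (r : ℝ) (f : Policy) (ω : Noise) (k : ℕ) :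
    (numSucc (history r f ω k).1 (history r f ω k).2 : ℝ) =
      ∑ t ∈ Finset.range k, success r f ω t := by
  induction k with
  | zero => simp [numSucc]
  | succ k ih =>
    rw [Finset.sum_range_succ, ← ih, numSucc, numSucc, Finset.card_filter, Finset.card_filter,
      Fin.sum_univ_castSucc, history_succ, Nat.cast_add]
    congr 1
    · simp only [Fin.snoc_castSucc, Fin.succ_castSucc]
    · rw [success, action_eq_below]
      simp only [Fin.snoc_last, Fin.succ_last, below, decide_eq_true_eq]
      by_cases h1 : ((ω k).1 : ℝ) < txProb r f ω k <;> by_cases h2 : ((ω k).2 : ℝ) < r <;>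
        simp [h1, h2]

theorem numSucc_add_numFail_history (r : ℝ) (f : Policy) (ω : Noise) (k : ℕ) :
    (numSucc (history r f ω k).1 (history r f ω k).2 : ℝ) +
      numFail (history r f ω k).1 (history r f ω k).2 =
      ∑ t ∈ Finset.range k, action r f ω t := by
  have h : ∀ {k : ℕ} (τ : Fin (k + 1) → ℕ) (a : Fin k → Bool),
      numSucc τ a + numFail τ a = (Finset.univ.filter fun j : Fin k => a j = true).card := by
    intro k τ a
    rw [numSucc, numFail, ← Finset.filter_filter, ← Finset.filter_filter]
    exact Finset.card_filter_add_card_filter_not _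
  rw [← Nat.cast_add, h]
  induction k with
  | zero => simp
  | succ k ih =>
    rw [Finset.sum_range_succ, ← ih, Finset.card_filter, Finset.card_filter,
      Fin.sum_univ_castSucc, Nat.cast_add]
    congr 1
    · simp only [history_succ, Fin.snoc_castSucc]
    · rw [action]
      split_ifs <;> simp

theorem admissible_learningPolicy {b : ℝ} (hb : b ∈ Set.Ioc (0 : ℝ) 1) :
    Admissible (learningPolicy b) := by
  intro k τ a
  simp only [learningPolicy, learnedRule]
  split_ifs with h
  · simp
  · have h1 : 0 < (numSucc τ a : ℝ) := by exact_mod_cast Nat.pos_of_ne_zero h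
    have h2 : 0 < rateEstimate τ a := div_pos h1 (by positivity)
    rw [closedFormRule_eq_ramp hb h2]
    exact ramp_mem _ _

section Learning

variable {b r : ℝ}

/-- Number of successes of the learning policy before time `k`. -/
def learnSucc (b r : ℝ) (ω : Noise) (k : ℕ) : ℝ :=
  ∑ t ∈ Finset.range k, success r (learningPolicy b) ω t

/-- Number of transmissions of the learning policy before time `k`. -/
def learnSent (b r : ℝ) (ω : Noise) (k : ℕ) : ℝ :=
  ∑ t ∈ Finset.range k, action r (learningPolicy b) ω t

theorem learnedRuleAt_eq (hb : b ∈ Set.Ioc (0 : ℝ) 1) (ω : Noise) (k : ℕ) :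
    learnedRuleAt b r ω k = if learnSucc b r ω k = 0 then fun _ => 1
      else ramp (rampPoint b (learnSucc b r ω k / learnSent b r ω k)) := by
  have h1 := numSucc_history r (learningPolicy b) ω k
  have h2 := numSucc_add_numFail_history r (learningPolicy b) ω k
  rw [learnedRuleAt, learnedRule]
  set τ := (history r (learningPolicy b) ω k).1
  set a := (history r (learningPolicy b) ω k).2
  by_cases h : numSucc τ a = 0
  · rw [if_pos h, if_pos]
    rw [learnSucc, ← h1, h, Nat.cast_zero]
  · have h3 : 0 < (numSucc τ a : ℝ) := by exact_mod_cast Nat.pos_of_ne_zero h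
    have h4 : 0 < rateEstimate τ a := div_pos h3 (by positivity)
    rw [if_neg h, if_neg (by rw [learnSucc, ← h1]; exact h3.ne'), closedFormRule_eq_ramp hb h4,
      rateEstimate, h2, h1, learnSucc, learnSent]

theorem txProb_learningPolicy (ω : Noise) (k : ℕ) :
    txProb r (learningPolicy b) ω k = learnedRuleAt b r ω k (tau r (learningPolicy b) ω k) := rfl

/-- If transmissions stopped, the estimate would freeze while the holding time grew past the frozen
ramp point, where the rule transmits surely. -/
theorem tendsto_learnSent (hb : b ∈ Set.Ioc (0 : ℝ) 1) {ω : Noise}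
    (hω : ∀ k : ℕ, ((ω k).1 : ℝ) < 1) : Tendsto (learnSent b r ω) atTop atTop := by
  set f := learningPolicy b with hf
  by_contra hcon
  have hbdd : ∃ B, ∀ T, learnSent b r ω T ≤ B := by
    by_contra! hB
    exact hcon (tendsto_atTop_atTop_of_monotone (monotone_nat_of_le_succ fun T => by
      rw [learnSent, learnSent, Finset.sum_range_succ]
      linarith [(action_mem r f ω T).1]) fun B => (hB B).imp fun T hT => hT.le)
  obtain ⟨B, hB⟩ := hbdd
  have hsum : Summable fun t => action r f ω t :=
    summable_of_sum_range_le (fun t => (action_mem r f ω t).1) hB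
  obtain ⟨t₀, ht₀⟩ := eventually_atTop.1
    (hsum.tendsto_atTop_zero.eventually_lt_const (zero_lt_one' ℝ))
  have hact : ∀ t, t₀ ≤ t → action r f ω t = 0 := fun t ht =>
    (action_eq_zero_or_one r f ω t).resolve_right (ht₀ t ht).ne
  have hsucc : ∀ t, t₀ ≤ t → success r f ω t = 0 := fun t ht => by
    rw [success, hact t ht, zero_mul]
  have htau : ∀ n, tau r f ω (t₀ + n) = tau r f ω t₀ + n := fun n => by
    induction n with
    | zero => rfl
    | succ n ih =>
      rw [← add_assoc, tau_succ, hsucc _ (Nat.le_add_right _ _), ih]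
      simp [add_assoc]
  have hS : ∀ n, learnSucc b r ω (t₀ + n) = learnSucc b r ω t₀ := fun n => by
    rw [learnSucc, Finset.sum_range_add,
      Finset.sum_eq_zero fun t _ => hsucc _ (Nat.le_add_right _ _),
      add_zero, learnSucc]
  have hN : ∀ n, learnSent b r ω (t₀ + n) = learnSent b r ω t₀ := fun n => by
    rw [learnSent, Finset.sum_range_add,
      Finset.sum_eq_zero fun t _ => hact _ (Nat.le_add_right _ _),
      add_zero, learnSent]
  obtain ⟨n, hn⟩ := exists_nat_ge (rampPoint b (learnSucc b r ω t₀ / learnSent b r ω t₀))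
  have htx : txProb r f ω (t₀ + n) = 1 := by
    rw [txProb_learningPolicy, learnedRuleAt_eq hb, hS, hN]
    split_ifs
    · rfl
    · refine ramp_of_le (hn.trans ?_)
      rw [← hf, htau]
      push_cast
      linarith [(Nat.cast_nonneg (tau r f ω t₀) : (0 : ℝ) ≤ _)]
  have := hact (t₀ + n) (Nat.le_add_right _ _)
  rw [action_eq_below, htx, below, if_pos (hω _)] at this
  exact one_ne_zero this

/-- The sequence `y` is the ramp point of the estimate. Since the estimate tends to `r > 0`,
eventually there has been a success. -/
theorem ae_exists_learnedRuleAt_eq_ramp (hb : b ∈ Set.Ioc (0 : ℝ) 1)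
    (hr : r ∈ Set.Ioc (0 : ℝ) 1) :
    ∀ᵐ ω ∂noise, ∃ y : ℕ → ℝ, Tendsto y atTop (𝓝 (rampPoint b r)) ∧
      ∀ᶠ k in atTop, learnedRuleAt b r ω k = ramp (y k) := by
  have hr' : r ∈ Set.Icc (0 : ℝ) 1 := ⟨hr.1.le, hr.2⟩
  set f := learningPolicy b with hf
  have hlln := ae_tendsto_of_orthogonal (a := fun t ω => action r f ω t)
    (X := fun t ω => success r f ω t - r * action r f ω t) (measurable_action r f)
    (fun t ω => action_eq_zero_or_one r f ω t)
    (fun t => (measurable_success r f t).sub ((measurable_action r f t).const_mul r))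
    (fun t ω => by
      have h1 := below_mem r (ω t).2
      rw [success]
      rcases action_eq_zero_or_one r f ω t with h | h
      · simp [h]
      · rw [h, one_mul, mul_one]
        exact abs_sub_le_one h1 hr')
    (fun t H hH hHb => integral_mul_success_sub_action f hr' t hH hHb)
  filter_upwards [hlln, ae_noise_fst_lt_one] with ω h1 h2
  have hN := tendsto_learnSent (r := r) hb h2
  have h3 : Tendsto (fun k => learnSucc b r ω k / learnSent b r ω k) atTop (𝓝 r) := by
    have := (h1 hN).add_const r
    rw [zero_add] at this
    refine this.congr' ?_
    filter_upwards [hN.eventually_gt_atTop 0] with k hk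
    rw [Finset.sum_sub_distrib, ← Finset.mul_sum]
    change (learnSucc b r ω k - r * learnSent b r ω k) / learnSent b r ω k + r = _
    field_simp
    ring
  refine ⟨_, tendsto_rampPoint hb.1 hr.1 h3, ?_⟩
  filter_upwards [h3.eventually_const_lt hr.1] with k hk
  rw [learnedRuleAt_eq hb, if_neg]
  intro h
  rw [h, zero_div] at hk
  exact lt_irrefl _ hk

/-! ## Empirical occupation of holding times -/

theorem Admissible.ae_tendsto_avg_innovation {f : Policy} (hf : Admissible f)
    (hr : r ∈ Set.Icc (0 : ℝ) 1) {G : ℕ → ℝ} (hG : ∀ n, G n ∈ Set.Icc (0 : ℝ) 1) :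
    ∀ᵐ ω ∂noise, Tendsto (fun T : ℕ => 1 / (T : ℝ) * ∑ t ∈ Finset.range T,
      G (tau r f ω t) * (success r f ω t - r * txProb r f ω t)) atTop (𝓝 0) := by
  have hGm := fun t => measurable_comp_tau r f t G
  have h := ae_tendsto_of_orthogonal (a := fun _ _ => 1)
    (X := fun t ω => G (tau r f ω t) * (success r f ω t - r * txProb r f ω t))
    (fun _ => measurable_const) (fun _ _ => Or.inr rfl)
    (fun t => ((hGm t).mono (past.mono t.le_succ) le_rfl).mul ((measurable_success r f t).sub
      (((measurable_txProb r f t).mono (past.mono t.le_succ) le_rfl).const_mul r)))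
    (fun t ω => by
      rw [abs_mul, abs_of_nonneg (hG _).1]
      exact mul_le_one₀ (hG _).2 (abs_nonneg _)
        (abs_sub_le_one (success_mem r f ω t) (mul_mem_unit hr (hf.txProb_mem r ω t))))
    (fun t H hH ⟨B, hB⟩ => by
      have := hf.integral_mul_success_sub hr t (H := fun ω => H ω * G (tau r f ω t))
        (hH.mul (hGm t)) ⟨B, fun ω => by
          rw [abs_mul, abs_of_nonneg (hG _).1]
          exact (mul_le_of_le_one_right (abs_nonneg _) (hG _).2).trans (hB ω)⟩
      simpa only [mul_assoc] using this)
  filter_upwards [h] with ω hω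
  have h1 := hω (by simpa using tendsto_natCast_atTop_atTop)
  refine h1.congr fun T => ?_
  simp only [Finset.sum_const, Finset.card_range, nsmul_eq_mul, mul_one]
  rw [div_eq_inv_mul, one_div]

/-- Fraction of the times before `T` at which the holding time of the learning policy is `j`. -/
def empirical (b r : ℝ) (ω : Noise) (T j : ℕ) : ℝ :=
  1 / (T : ℝ) * ∑ t ∈ Finset.range T, eqInd j (tau r (learningPolicy b) ω t)

theorem tendsto_avg_of_tendsto_zero {v : ℕ → ℝ} (hv : Tendsto v atTop (𝓝 0)) :
    Tendsto (fun T : ℕ => 1 / (T : ℝ) * ∑ t ∈ Finset.range T, v t) atTop (𝓝 0) := by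
  simpa only [one_div] using hv.cesaro

theorem ae_tendsto_empirical (hb : b ∈ Set.Ioc (0 : ℝ) 1) (hr : r ∈ Set.Ioc (0 : ℝ) 1) :
    ∀ᵐ ω ∂noise, ∀ j, Tendsto (fun T => empirical b r ω T j) atTop
      (𝓝 (occupation r (ramp (rampPoint b r)) (threshold b r + 1) j)) := by
  have hr' : r ∈ Set.Icc (0 : ℝ) 1 := ⟨hr.1.le, hr.2⟩
  set f := learningPolicy b with hf
  set x := rampPoint b r with hx
  set K := threshold b r + 1 with hK
  have hadm : Admissible f := admissible_learningPolicy hb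
  filter_upwards [ae_exists_learnedRuleAt_eq_ramp hb hr,
    ae_all_iff.2 fun j => hadm.ae_tendsto_avg_innovation hr' (eqInd_mem j),
    hadm.ae_tendsto_avg_innovation hr' (geInd_mem K)] with ω ⟨y, hy, hyr⟩ h1 h2
  have htx : ∀ᶠ t in atTop, txProb r f ω t = ramp (y t) (tau r f ω t) :=
    hyr.mono fun t ht => by rw [txProb_learningPolicy, ht]
  refine tendsto_occupation hr (ramp_mem x)
    (u := fun T => 1 / (T : ℝ) * ∑ t ∈ Finset.range T, geInd K (tau r f ω t)) ?_ (fun j => ?_) ?_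
  · filter_upwards [eventually_ne_atTop 0] with T hT
    have hT' : (T : ℝ) ≠ 0 := by exact_mod_cast hT
    simp only [empirical, ← hf]
    rw [← Finset.mul_sum, Finset.sum_comm, ← mul_add, ← Finset.sum_add_distrib]
    simp_rw [sum_eqInd_add_geInd]
    simp [hT']
  · have h3 := tendsto_avg_telescope fun t => eqInd_mem (j + 1) (tau r f ω t)
    -- Replacing the current rule by its limit costs at most `|y t - x|`, which vanishes.
    have h4 : Tendsto (fun t => eqInd j (tau r f ω t) * (r * txProb r f ω t - r * ramp x j)) atTop
        (𝓝 0) := by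
      refine squeeze_zero_norm' (a := fun t => |y t - x|) ?_ ?_
      · filter_upwards [htx] with t ht
        rw [ht, Real.norm_eq_abs]
        unfold eqInd
        split_ifs with h
        · rw [one_mul, h, ← mul_sub, abs_mul, abs_of_pos hr.1]
          exact (mul_le_of_le_one_left (abs_nonneg _) hr.2).trans (abs_ramp_sub_le _ _ _)
        · simp
      · simpa [← hx] using (hy.sub_const x).abs
    have h5 := ((h3.add (h1 j)).add (tendsto_avg_of_tendsto_zero h4)).neg
    simp only [add_zero, neg_zero] at h5
    refine h5.congr fun T => ?_
    simp only [empirical]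
    rw [← mul_add, ← mul_add, ← Finset.sum_add_distrib, ← Finset.sum_add_distrib, ← mul_neg,
      ← Finset.sum_neg_distrib, mul_assoc, ← mul_sub, Finset.sum_mul, ← Finset.sum_sub_distrib]
    congr 1
    refine Finset.sum_congr rfl fun t _ => ?_
    rw [apply_tau_succ (eqInd (j + 1))]
    simp only [eqInd_succ_succ, eqInd_succ_zero]
    ring
  · have h3 := tendsto_avg_telescope fun t => geInd_mem (K + 1) (tau r f ω t)
    -- Here the error is eventually exactly zero: once `y t < K`, the current rule transmits surely
    -- from `K` on.
    have h4 : Tendsto (fun t => geInd K (tau r f ω t) * (r * txProb r f ω t - r)) atTop (𝓝 0) := by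
      refine tendsto_const_nhds.congr' ?_
      filter_upwards [htx, hy.eventually_lt_const (rampPoint_lt (b := b) (r := r))] with t ht hyt
      rw [ht]
      unfold geInd
      split_ifs with h
      · rw [ramp_of_le (hyt.le.trans (by exact_mod_cast h))]
        ring
      · ring
    have h5 := (h3.add h2).add (tendsto_avg_of_tendsto_zero h4)
    simp only [add_zero] at h5
    refine h5.congr fun T => ?_
    simp only [empirical]
    rw [← mul_add, ← mul_add, ← Finset.sum_add_distrib, ← Finset.sum_add_distrib, mul_left_comm,
      ← mul_sub, Finset.mul_sum _ _ r, ← Finset.sum_sub_distrib]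
    congr 1
    refine Finset.sum_congr rfl fun t _ => ?_
    rw [apply_tau_succ (geInd (K + 1)), ← hf]
    simp only [geInd_succ_succ, geInd_succ_zero]
    rw [← eqInd_add_geInd K]
    ring

/-! ## Average cost along the run of the learning policy -/

/-- When the channel is good, the run length drops to `0` and the next holding time is at most `K`:
from `K` on a transmission is certain and succeeds. When the channel fails, both quantities grow by
one. -/
theorem exists_tau_le_runLength_add {f : Policy} {ω : Noise} (hω : ∀ k : ℕ, ((ω k).1 : ℝ) < 1)
    {K t₀ : ℕ} (h : ∀ t, t₀ ≤ t → K ≤ tau r f ω t → txProb r f ω t = 1) :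
    ∃ C, ∀ t, t₀ ≤ t → tau r f ω t ≤ runLength r ω t + C := by
  refine ⟨max K (tau r f ω t₀), fun t ht => ?_⟩
  induction t, ht using Nat.le_induction with
  | base => exact (le_max_right _ _).trans (Nat.le_add_left _ _)
  | succ t ht ih =>
    rw [tau_succ, runLength]
    have hK := le_max_left K (tau r f ω t₀)
    by_cases h1 : ((ω t).2 : ℝ) < r
    · rw [if_pos h1]
      by_cases h2 : K ≤ tau r f ω t
      · rw [if_pos]
        · omega
        · rw [success, action_eq_below, h t ht h2, below, below, if_pos (hω t), if_pos h1, one_mul]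
      · split_ifs <;> omega
    · rw [if_neg h1]
      split_ifs <;> omega

theorem ae_tendsto_avg_cost {c : ℕ → ℝ} (hc : ∀ j, 0 ≤ c j) (hmono : Monotone c)
    (hb : b ∈ Set.Ioc (0 : ℝ) 1) (hr : r ∈ Set.Ioc (0 : ℝ) 1) :
    ∀ᵐ ω ∂noise, Tendsto (fun T : ℕ => ENNReal.ofReal (1 / (T : ℝ) *
      ∑ t ∈ Finset.range T, c (tau r (learningPolicy b) ω t))) atTop
        (𝓝 (avgCost c r (ramp (rampPoint b r)) (threshold b r + 1))) := by
  have hr' : r ∈ Set.Icc (0 : ℝ) 1 := ⟨hr.1.le, hr.2⟩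
  set f := learningPolicy b with hf
  set K := threshold b r + 1 with hK
  -- The constant `C` will depend on the path, so the exceptional null set must serve all `C` at
  -- once.
  have hruns : ∀ᵐ ω ∂noise, ∀ C : ℕ, avgCost c r (ramp (rampPoint b r)) K ≠ ∞ →
      ∀ ε : ℝ, 0 < ε → ∃ L, ∀ T : ℕ, ∑ t ∈ Finset.range T,
        (if L ≤ runLength r ω t then ENNReal.ofReal (c (runLength r ω t + C)) else 0) ≤
          ENNReal.ofReal ε * T := by
    by_cases hV : avgCost c r (ramp (rampPoint b r)) K = ∞
    · exact ae_of_all _ fun ω C h => absurd hV h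
    · rw [ae_all_iff]
      intro C
      filter_upwards [ae_sum_long_runs_le hr' (d := fun i => ENNReal.ofReal (c (i + C)))
        (tsum_geometric_ne_top_of_avgCost_ne_top hr (ramp_mem _) hV C)] with ω hω _
      exact hω
  have hexp : ∀ ω (c' : ℕ → ℝ), (∀ j, 0 ≤ c' j) → ∀ T : ℕ,
      ENNReal.ofReal (1 / (T : ℝ) * ∑ t ∈ Finset.range T, c' (tau r f ω t)) =
        ∑' j, ENNReal.ofReal (c' j) * ENNReal.ofReal (empirical b r ω T j) := by
    intro ω c' hc' T
    rw [sum_comp_eq_sum_eqInd c' (tau_le r f ω), Finset.mul_sum,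
      ← ofReal_sum_range_mul (T := T) hc' (fun j => ?_) fun j hj => ?_]
    · congr 1
      refine Finset.sum_congr rfl fun j _ => ?_
      rw [empirical]
      ring
    · exact mul_nonneg (by positivity) (Finset.sum_nonneg fun t _ => (eqInd_mem j _).1)
    · rw [empirical, sum_eqInd_eq_zero (tau_le r _ ω) hj, mul_zero]
  filter_upwards [ae_tendsto_empirical hb hr, hruns, ae_noise_fst_lt_one,
    ae_exists_learnedRuleAt_eq_ramp hb hr] with ω h1 h2 h3 ⟨y, hy, hyr⟩
  simp_rw [hexp ω c hc]
  refine tendsto_tsum_mul_of_tail (fun _ => ENNReal.ofReal_ne_top)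
    (fun j => ENNReal.tendsto_ofReal (h1 j)) fun hV ε hε => ?_
  obtain ⟨t₀, ht₀⟩ := eventually_atTop.1
    (hyr.and (hy.eventually_lt_const (rampPoint_lt (b := b) (r := r))))
  obtain ⟨C, hC⟩ := exists_tau_le_runLength_add (r := r) (f := f) (K := K) (t₀ := t₀) h3
    fun t ht hKt => by
      rw [txProb_learningPolicy, (ht₀ t ht).1]
      exact ramp_of_le ((ht₀ t ht).2.le.trans (by exact_mod_cast hKt))
  obtain ⟨δ, hδ, hδε⟩ : ∃ δ : ℝ, 0 < δ ∧ ENNReal.ofReal δ + ENNReal.ofReal δ ≤ ε := by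
    obtain ⟨ε', hε'0, hε'⟩ := ENNReal.lt_iff_exists_nnreal_btwn.1 hε
    refine ⟨ε' / 2, by simpa using hε'0, ?_⟩
    rw [← ENNReal.ofReal_add (by positivity) (by positivity), add_halves, ENNReal.ofReal_coe_nnreal]
    exact hε'.le
  obtain ⟨L, hL⟩ := h2 C hV δ hδ
  -- From `t₀` on, a holding time of at least `L + C` forces a run of length at least `L`; the
  -- earlier times contribute at most the constant `D`.
  refine ⟨L + C, ?_⟩
  set D : ℝ≥0∞ := ∑ t ∈ Finset.range t₀, ENNReal.ofReal (c (tau r f ω t)) with hD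
  have hDfin : D ≠ ∞ := ENNReal.sum_ne_top.2 fun _ _ => ENNReal.ofReal_ne_top
  set c' : ℕ → ℝ := fun n => c n * geInd (L + C) n with hc'
  have hc'0 : ∀ n, 0 ≤ c' n := fun n => mul_nonneg (hc n) (geInd_mem _ n).1
  have hterm : ∀ t, ENNReal.ofReal (c' (tau r f ω t)) ≤
      (if t < t₀ then ENNReal.ofReal (c (tau r f ω t)) else 0) +
      (if L ≤ runLength r ω t then ENNReal.ofReal (c (runLength r ω t + C)) else 0) := by
    intro t
    by_cases ht : t < t₀
    · rw [if_pos ht]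
      refine le_add_right (ENNReal.ofReal_le_ofReal ?_)
      exact mul_le_of_le_one_right (hc _) (geInd_mem _ _).2
    · rw [if_neg ht, zero_add]
      have hle := hC t (not_lt.1 ht)
      simp only [hc', geInd]
      split_ifs with h4 h5
      · rw [mul_one]
        exact ENNReal.ofReal_le_ofReal (hmono hle)
      · omega
      · simp
      · simp
  obtain ⟨T₀, hT₀⟩ := exists_nat_ge (D.toReal / δ)
  filter_upwards [eventually_ge_atTop (max T₀ 1)] with T hT
  have hT1 : 0 < (T : ℝ) := by
    have := (le_max_right _ _).trans hT
    exact_mod_cast this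
  have hDT : D ≤ ENNReal.ofReal δ * T := by
    rw [← ENNReal.ofReal_natCast, ← ENNReal.ofReal_mul hδ.le]
    refine (ENNReal.le_ofReal_iff_toReal_le hDfin (by positivity)).2 ?_
    have h5 : (T₀ : ℝ) ≤ T := by exact_mod_cast (le_max_left _ _).trans hT
    rw [mul_comm]
    exact (div_le_iff₀ hδ).1 (hT₀.trans h5)
  calc ∑' j, ENNReal.ofReal (c (j + (L + C))) * ENNReal.ofReal (empirical b r ω T (j + (L + C)))
      = ∑' j, ENNReal.ofReal (c' (j + (L + C))) *
          ENNReal.ofReal (empirical b r ω T (j + (L + C))) := by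
        simp [hc', geInd]
    _ ≤ ∑' j, ENNReal.ofReal (c' j) * ENNReal.ofReal (empirical b r ω T j) :=
        ENNReal.tsum_comp_le_tsum_of_injective (add_left_injective (L + C))
          (fun j => ENNReal.ofReal (c' j) * ENNReal.ofReal (empirical b r ω T j))
    _ = ENNReal.ofReal (1 / (T : ℝ)) * ∑ t ∈ Finset.range T, ENNReal.ofReal (c' (tau r f ω t)) := by
        rw [← hexp ω c' hc'0, ENNReal.ofReal_mul (by positivity),
          ENNReal.ofReal_sum_of_nonneg fun t _ => hc'0 _]
    _ ≤ ENNReal.ofReal (1 / (T : ℝ)) * (D + ENNReal.ofReal δ * T) := by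
        gcongr
        refine (Finset.sum_le_sum fun t _ => hterm t).trans ?_
        rw [Finset.sum_add_distrib]
        refine add_le_add ?_ (hL T)
        rw [← Finset.sum_filter]
        refine Finset.sum_le_sum_of_subset fun t ht => ?_
        exact Finset.mem_range.2 (Finset.mem_filter.1 ht).2
    _ ≤ ENNReal.ofReal (1 / (T : ℝ)) * (ENNReal.ofReal δ * T + ENNReal.ofReal δ * T) := by gcongr
    _ = ENNReal.ofReal δ + ENNReal.ofReal δ := by
        rw [← add_mul, mul_comm, mul_assoc, ← ENNReal.ofReal_natCast,
          ← ENNReal.ofReal_mul hT1.le, mul_one_div_cancel hT1.ne', ENNReal.ofReal_one, mul_one]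
    _ ≤ ε := hδε

end Learning

end

end SensorScheduling

theorem theorem5 {n m : ℕ} (A : Matrix (Fin n) (Fin n) ℝ) (C : Matrix (Fin m) (Fin n) ℝ)
    (W : Matrix (Fin n) (Fin n) ℝ) (V : Matrix (Fin m) (Fin m) ℝ)
    (hW : W.PosSemidef) (hV : V.PosDef)
    (P : Matrix (Fin n) (Fin n) ℝ) (hP : SensorScheduling.IsSteadyStateCov A C W V P)
    (r : ℝ) (hr : r ∈ Set.Ioc (0 : ℝ) 1) (b : ℝ) (hb : b ∈ Set.Ioc (0 : ℝ) 1) :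
    -- the closed-form policy at the true success probability solves the constrained problem
    SensorScheduling.IsOptimal (SensorScheduling.errCost A W P) r b
      (SensorScheduling.stationary (SensorScheduling.closedFormRule b r)) ∧
    -- the learning policy is an admissible policy
    SensorScheduling.Admissible (SensorScheduling.learningPolicy b) ∧
    -- the learned policies converge almost surely to that optimal policy
    (∀ᵐ ω ∂SensorScheduling.noise,
      TendstoUniformly (fun k : ℕ => SensorScheduling.learnedRuleAt b r ω k)
        (SensorScheduling.closedFormRule b r) atTop) ∧
    -- the average estimation error along the run of the learning policy converges
    -- almost surely to the optimal value
    (∀ᵐ ω ∂SensorScheduling.noise,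
      Tendsto (fun k : ℕ =>
          (((1 / ((k : ℝ) + 1)) * ∑ t ∈ Finset.range (k + 1),
            SensorScheduling.errCost A W P
              (SensorScheduling.tau r (SensorScheduling.learningPolicy b) ω t) : ℝ) : EReal))
        atTop (𝓝 (SensorScheduling.optValue (SensorScheduling.errCost A W P) r b))) ∧
    -- so does the expected average estimation error of the policy learned by time `k`
    (∀ᵐ ω ∂SensorScheduling.noise,
      Tendsto (fun k : ℕ =>
          SensorScheduling.Je (SensorScheduling.errCost A W P) r
            (SensorScheduling.stationary (SensorScheduling.learnedRuleAt b r ω k)))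
        atTop (𝓝 (SensorScheduling.optValue (SensorScheduling.errCost A W P) r b))) := by
  have hc := hP.errCost_nonneg hW hV
  have hmono := hP.errCost_monotone hW hV
  rw [SensorScheduling.optValue_eq_avgCost hc hmono hb hr]
  refine ⟨SensorScheduling.isOptimal_closedFormRule hc hmono hb hr,
    SensorScheduling.admissible_learningPolicy hb, ?_, ?_, ?_⟩
  · filter_upwards [SensorScheduling.ae_exists_learnedRuleAt_eq_ramp hb hr] with ω ⟨y, hy, hyr⟩
    rw [Metric.tendstoUniformly_iff]
    intro ε hε
    filter_upwards [hyr, (Metric.tendsto_nhds.1 hy) ε hε] with k hk hyk j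
    rw [hk, SensorScheduling.closedFormRule_eq_ramp hb hr.1, dist_comm]
    exact (SensorScheduling.abs_ramp_sub_le _ _ j).trans_lt hyk
  · filter_upwards [SensorScheduling.ae_tendsto_avg_cost hc hmono hb hr] with ω hω
    refine ((continuous_coe_ennreal_ereal.tendsto _).comp
      (hω.comp (tendsto_add_atTop_nat 1))).congr fun k => ?_
    simp only [Function.comp_apply]
    rw [EReal.coe_ennreal_ofReal, max_eq_left]
    · push_cast
      rfl
    · exact mul_nonneg (by positivity) (Finset.sum_nonneg fun _ _ => hc _)
  · filter_upwards [SensorScheduling.ae_exists_learnedRuleAt_eq_ramp hb hr] with ω ⟨y, hy, hyr⟩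
    refine ((continuous_coe_ennreal_ereal.tendsto _).comp (SensorScheduling.tendsto_avgCost_ramp
      hr SensorScheduling.rampPoint_lt hy)).congr' ?_
    -- The cutoff `K` stays the one belonging to the true `r`, valid for the learned rule as soon as
    -- `y k` lies below it.
    filter_upwards [hyr, hy.eventually_lt_const SensorScheduling.rampPoint_lt] with k hk hyk
    rw [hk, SensorScheduling.Je_stationary hc hr (SensorScheduling.ramp_mem _) fun j hj =>
      SensorScheduling.ramp_of_le (hyk.le.trans (by exact_mod_cast hj))]
    rfl
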